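/- Conventions. A surface is a smooth Riemannian $2$-manifold $S$ (without boundary; not assumed oriented, orientable, complete or connected), $UTS$ is its unit tangent bundle, and $D$ denotes covariant differentiation along a curve for the Levi-Civita connection. For a regular curve $\gamma\colon[0,1]\to S$ of class $C^2$ let $\tau_\gamma=\dot\gamma/|\dot\gamma|\colon [0,1]\to UTS$ be its unit tangent. Given an orientation of $TS_{\gamma(0)}$, the unit normal $n_\gamma$ is determined by the condition that, for each $t\in[0,1]$, $(\tau_\gamma(t),n_\gamma(t))$ is an orthonormal basis of $TS_{\gamma(t)}$ whose parallel translation to $\gamma(0)$ along the inverse of $\gamma$ is positively oriented, and the curvature of $\gamma$ is $$\kappa_\gamma=\frac{1}{|\dot\gamma|^2}\Big\langle \frac{D\dot\gamma}{dt},n_\gamma\Big\rangle .$$ Let $\kappa_1<\kappa_2$ in $\mathbb R\cup\{\pm\infty\}$, $r\in\{2,3,\dots,\infty\}$, $u,v\in UTS$, and fix an orientation of the tangent plane $TS_p$ at the base point $p$ of $u$. Then $\mathcal CS_{\kappa_1}^{\kappa_2}(u,v)$ denotes the set of all $C^r$ regular curves $\gamma\colon[0,1]\to S$ such that $\tau_\gamma(0)=u$,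 $\tau_\gamma(1)=v$ and $\kappa_1<\kappa_\gamma(t)<\kappa_2$ for all $t\in[0,1]$, endowed with the $C^r$ topology. Lemma 5.3. Let $q\colon\tilde S\to S$ be a Riemannian covering, i.e., a covering map between surfaces which is also a local isometry, and let $u,v\in UTS$. Let $\tilde u\in UT\tilde S$ be a lift of $u$, i.e., $dq(\tilde u)=u$, and let $p$, $\tilde p$ be the base points of $u$, $\tilde u$. Suppose that orientations of $T\tilde S_{\tilde p}$ and $TS_p$ have been chosen and that $dq\colon T\tilde S_{\tilde p}\to TS_p$ preserves them. Then $\tilde\gamma\mapsto q\circ\tilde\gamma$ yields a homeomorphism $$\bigsqcup_{\tilde v\in dq^{-1}(v)}\mathcal C\tilde S_{\kappa_1}^{\kappa_2}(\tilde u,\tilde v)\;\approx\;\mathcal CS_{\kappa_1}^{\kappa_2}(u,v),$$ where the left-hand side carries the disjoint union topology and the same $r$ is used on both sides. -/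

import Mathlib

open scoped Manifold ContDiff

noncomputable section

namespace CurveSpaces

/-- The coordinate plane `ℝ²` on which surfaces are modelled. -/
abbrev Plane : Type := EuclideanSpace ℝ (Fin 2)

/-- The `i`-th vector of the standard basis of `ℝ²`. -/
abbrev stdVec (i : Fin 2) : Plane := EuclideanSpace.single i (1 : ℝ)

section Surface

variable {S : Type*} [TopologicalSpace S] [ChartedSpace Plane S] [IsManifold (𝓡 2) ∞ S]

variable (S) in
/-- A smooth Riemannian metric on the surface `S`. -/
abbrev SurfaceMetric : Type _ :=
  Bundle.ContMDiffRiemannianMetric (𝓡 2) ∞ Plane (fun x : S => TangentSpace (𝓡 2) x)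

/-- The unit tangent bundle of a surface with a Riemannian metric (as a set). -/
abbrev UnitTangent (g : SurfaceMetric S) : Type _ :=
  {w : TangentBundle (𝓡 2) S // g.inner w.proj w.2 w.2 = 1}

/-! ### The Levi-Civita connection in charts -/

/-- The matrix `(g_ij)` of the metric in the chart `φ`, at the point of coordinates `y`:
`g_ij = ⟨∂_i, ∂_j⟩`, where `∂_i` is the coordinate vector field of `φ`. -/
def metricMatrix (g : SurfaceMetric S) (φ : OpenPartialHomeomorph S Plane) (y : Plane) :
    Matrix (Fin 2) (Fin 2) ℝ :=
  Matrix.of fun i j =>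
    g.inner (φ.symm y) (mfderiv (𝓡 2) (𝓡 2) φ.symm y (stdVec i))
      (mfderiv (𝓡 2) (𝓡 2) φ.symm y (stdVec j))

/-- The partial derivative `∂_l g_ij` in the chart `φ`. -/
def metricPartial (g : SurfaceMetric S) (φ : OpenPartialHomeomorph S Plane)
    (l i j : Fin 2) (y : Plane) : ℝ :=
  fderiv ℝ (fun z => metricMatrix g φ z i j) y (stdVec l)

/-- The Christoffel symbols of the Levi-Civita connection in the chart `φ`:
`Γ^k_ij = ½ ∑_l g^kl (∂_i g_jl + ∂_j g_il - ∂_l g_ij)`. -/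
def christoffel (g : SurfaceMetric S) (φ : OpenPartialHomeomorph S Plane)
    (k i j : Fin 2) (y : Plane) : ℝ :=
  (1 / 2 : ℝ) * ∑ l : Fin 2, (metricMatrix g φ y)⁻¹ k l *
    (metricPartial g φ i j l y + metricPartial g φ j i l y - metricPartial g φ l i j y)

/-! ### Curves and vector fields along curves -/

/-- The velocity vector of a curve `γ : [0,1] → S`. -/
def velocity (γ : unitInterval → S) (t : unitInterval) : TangentSpace (𝓡 2) (γ t) :=
  mfderiv (𝓡∂ 1) (𝓡 2) γ t 1

/-- The components in the chart `φ` of a vector field `V` along `γ`, as a function of the real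
parameter `s` (only the values at `s ∈ [0,1]` with `γ s` in the domain of `φ` matter). -/
def components (φ : OpenPartialHomeomorph S Plane) (γ : unitInterval → S)
    (V : ∀ t, TangentSpace (𝓡 2) (γ t)) (s : ℝ) : Plane :=
  mfderiv (𝓡 2) (𝓡 2) φ (γ (Set.projIcc 0 1 zero_le_one s)) (V (Set.projIcc 0 1 zero_le_one s))

/-- The components in the chart `φ` of the covariant derivative of `V` along `γ` at the
parameter `t`: `dV^k/dt + ∑_ij Γ^k_ij (dγ^i/dt) V^j`. -/
def covDerivComponents (g : SurfaceMetric S) (φ : OpenPartialHomeomorph S Plane)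
    (γ : unitInterval → S) (V : ∀ t, TangentSpace (𝓡 2) (γ t)) (t : unitInterval) : Plane :=
  derivWithin (components φ γ V) (Set.Icc 0 1) t +
    WithLp.toLp 2 (fun k => ∑ i : Fin 2, ∑ j : Fin 2, christoffel g φ k i j (φ (γ t)) *
      components φ γ (velocity γ) t i * components φ γ V t j)

/-- The covariant derivative `DV/dt` (with respect to the Levi-Civita connection) of a vector
field `V` along `γ`, computed in the preferred chart at `γ t`. The result is a tangent vector that
does not depend on the chart used. -/
def covDeriv (g : SurfaceMetric S) (γ : unitInterval → S)
    (V : ∀ t, TangentSpace (𝓡 2) (γ t)) (t : unitInterval) : TangentSpace (𝓡 2) (γ t) :=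
  (mfderiv (𝓡 2) (𝓡 2) (chartAt Plane (γ t)) (γ t)).inverse
    (covDerivComponents g (chartAt Plane (γ t)) γ V t)

/-- `V` is a (differentiable) parallel vector field along `γ`. -/
def IsParallel (g : SurfaceMetric S) (γ : unitInterval → S)
    (V : ∀ t, TangentSpace (𝓡 2) (γ t)) : Prop :=
  ∀ t : unitInterval,
    DifferentiableWithinAt ℝ (components (chartAt Plane (γ t)) γ V) (Set.Icc 0 1) t ∧
      covDeriv g γ V t = 0

/-- The unit tangent `τ = γ' / |γ'|` of a regular curve. -/
def unitTangent (g : SurfaceMetric S) (γ : unitInterval → S) (t : unitInterval) :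
    TangentSpace (𝓡 2) (γ t) :=
  (√(g.inner (γ t) (velocity γ t) (velocity γ t)))⁻¹ • velocity γ t

/-- `(a, b)` is a positively oriented basis of the oriented tangent plane `T_p S`. -/
def IsPositiveBasis {p : S} (o : Orientation ℝ (TangentSpace (𝓡 2) p) (Fin 2))
    (a b : TangentBundle (𝓡 2) S) : Prop :=
  ∃ e : Module.Basis (Fin 2) ℝ (TangentSpace (𝓡 2) p),
    a = ⟨p, e 0⟩ ∧ b = ⟨p, e 1⟩ ∧ e.orientation = o

/-- `N` is the unit normal to the regular curve `γ` starting at `p`, with respect to the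
orientation `o` of `T_p S`: for each `t`, the pair `(τ t, N t)` is orthonormal and its parallel
translation to `γ 0 = p` (along the inverse of `γ`) is positively oriented. As parallel translation
is a well-defined isometry, exactly one `N` has this property for a given regular `C²` curve. -/
def IsUnitNormal (g : SurfaceMetric S) {p : S}
    (o : Orientation ℝ (TangentSpace (𝓡 2) p) (Fin 2)) (γ : unitInterval → S)
    (N : ∀ t, TangentSpace (𝓡 2) (γ t)) : Prop :=
  ∀ t : unitInterval,
    g.inner (γ t) (N t) (N t) = 1 ∧ g.inner (γ t) (unitTangent g γ t) (N t) = 0 ∧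
      ∃ A B : ∀ s, TangentSpace (𝓡 2) (γ s), IsParallel g γ A ∧ IsParallel g γ B ∧
        A t = unitTangent g γ t ∧ B t = N t ∧ IsPositiveBasis o ⟨γ 0, A 0⟩ ⟨γ 0, B 0⟩

/-- The curvature `κ = ⟨Dγ'/dt, N⟩ / |γ'|²` of `γ` with respect to the unit normal `N`. -/
def curvature (g : SurfaceMetric S) (γ : unitInterval → S)
    (N : ∀ t, TangentSpace (𝓡 2) (γ t)) (t : unitInterval) : ℝ :=
  g.inner (γ t) (covDeriv g γ (velocity γ) t) (N t) /
    g.inner (γ t) (velocity γ t) (velocity γ t)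

/-! ### The space of `C^r` curves -/

variable (S) in
/-- A curve `[0,1] → S` of class `C^r`. -/
structure CrCurve (r : ℕ∞) where
  /-- The underlying map. -/
  toFun : unitInterval → S
  contMDiff : ContMDiff (𝓡∂ 1) (𝓡 2) r toFun

/-- The basic neighbourhood of `γ₀` given by a chart `φ` whose domain contains the image by `γ₀`
of the compact set `K`, an order `k` and a number `ε`: those `γ` which map `K` into the domain of
`φ` and whose derivatives of orders `0, …, k` in this chart are `ε`-close on `K` to those
of `γ₀`. -/
def crNhd {r : ℕ∞} (γ₀ : CrCurve S r) (φ : OpenPartialHomeomorph S Plane)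
    (K : Set unitInterval) (k : ℕ) (ε : ℝ) : Set (CrCurve S r) :=
  {γ | ∀ t ∈ K, γ.toFun t ∈ φ.source ∧ ∀ j ≤ k,
    ‖iteratedDerivWithin j (fun s => φ (γ.toFun (Set.projIcc 0 1 zero_le_one s)))
        (Set.Icc 0 1) (t : ℝ) -
      iteratedDerivWithin j (fun s => φ (γ₀.toFun (Set.projIcc 0 1 zero_le_one s)))
        (Set.Icc 0 1) (t : ℝ)‖ < ε}

/-- The `C^r` topology on the set of `C^r` curves `[0,1] → S`. (For `r = ∞` this is uniform
convergence of all derivatives.) -/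
instance crTopology {r : ℕ∞} : TopologicalSpace (CrCurve S r) :=
  TopologicalSpace.generateFrom
    {U | ∃ (γ₀ : CrCurve S r) (φ : OpenPartialHomeomorph S Plane) (K : Set unitInterval)
        (k : ℕ) (ε : ℝ),
      φ ∈ IsManifold.maximalAtlas (𝓡 2) ∞ S ∧ IsCompact K ∧ (∀ t ∈ K, γ₀.toFun t ∈ φ.source) ∧
        (k : ℕ∞) ≤ r ∧ 0 < ε ∧ U = crNhd γ₀ φ K k ε}

/-- The conditions defining the space of curves: `γ` is regular, `τ(0) = u`, `τ(1) = v`, and the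
curvature of `γ`, with respect to the orientation `o` of the tangent plane at the base point
of `u`, takes values in `(κ₁, κ₂)`. -/
structure IsAdmissible (g : SurfaceMetric S) (κ₁ κ₂ : EReal) (u v : UnitTangent g)
    (o : Orientation ℝ (TangentSpace (𝓡 2) u.1.proj) (Fin 2)) (γ : unitInterval → S) : Prop where
  regular : ∀ t, velocity γ t ≠ 0
  initial : (⟨γ 0, unitTangent g γ 0⟩ : TangentBundle (𝓡 2) S) = u.1
  final : (⟨γ 1, unitTangent g γ 1⟩ : TangentBundle (𝓡 2) S) = v.1
  curvature_mem : ∃ N : ∀ t, TangentSpace (𝓡 2) (γ t), IsUnitNormal g o γ N ∧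
    ∀ t, κ₁ < (curvature g γ N t : EReal) ∧ (curvature g γ N t : EReal) < κ₂

/-- The space of `C^r` regular curves on `S` with `τ(0) = u`, `τ(1) = v` and curvature in
`(κ₁, κ₂)`, with the `C^r` topology (the subspace topology induced from `CrCurve S r`). -/
abbrev CurveSpace (g : SurfaceMetric S) (κ₁ κ₂ : EReal) (r : ℕ∞) (u v : UnitTangent g)
    (o : Orientation ℝ (TangentSpace (𝓡 2) u.1.proj) (Fin 2)) : Type _ :=
  {γ : CrCurve S r // IsAdmissible g κ₁ κ₂ u v o γ.toFun}

end Surface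

section Covering

variable {S' S : Type*}
  [TopologicalSpace S'] [ChartedSpace Plane S'] [IsManifold (𝓡 2) ∞ S']
  [TopologicalSpace S] [ChartedSpace Plane S] [IsManifold (𝓡 2) ∞ S]

/-- A Riemannian covering: a covering map which is also a local isometry (a local diffeomorphism
whose differential preserves the Riemannian metrics). -/
structure IsRiemannianCovering (g' : SurfaceMetric S') (g : SurfaceMetric S) (q : S' → S) :
    Prop where
  isCoveringMap : IsCoveringMap q
  isLocalDiffeomorph : IsLocalDiffeomorph (𝓡 2) (𝓡 2) ∞ q
  isometry : ∀ (x : S') (a b : TangentSpace (𝓡 2) x),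
    g.inner (q x) (mfderiv (𝓡 2) (𝓡 2) q x a) (mfderiv (𝓡 2) (𝓡 2) q x b) = g'.inner x a b

/-- The set `dq⁻¹(v)` of unit tangent vectors of `S'` which are lifts of `v`. -/
abbrev TangentLift (g' : SurfaceMetric S') (g : SurfaceMetric S) (q : S' → S)
    (v : UnitTangent g) : Type _ :=
  {v' : UnitTangent g' // tangentMap (𝓡 2) (𝓡 2) q v'.1 = v.1}

/-- The differential of `q` at `p'` maps positively oriented bases for `o'` to positively oriented
bases for `o`. -/
def PreservesOrientation (q : S' → S) {p' : S'} {p : S}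
    (o' : Orientation ℝ (TangentSpace (𝓡 2) p') (Fin 2))
    (o : Orientation ℝ (TangentSpace (𝓡 2) p) (Fin 2)) : Prop :=
  ∀ a b : TangentSpace (𝓡 2) p', IsPositiveBasis o' ⟨p', a⟩ ⟨p', b⟩ →
    IsPositiveBasis o (tangentMap (𝓡 2) (𝓡 2) q ⟨p', a⟩) (tangentMap (𝓡 2) (𝓡 2) q ⟨p', b⟩)

end Covering

end CurveSpaces

end

set_option linter.unusedSectionVars false

/-! The conditions defining the curve spaces are local and metric, so a Riemannian covering `q`
respects them: under `dq`, velocities, covariant derivatives, parallel fields, unit normals and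
curvatures of a curve and of its projection correspond. Hence a curve from the base point of `u'` to
that of a lift of `v` is admissible exactly when its projection is (`isAdmissible_comp_iff`). As the
connection is given by Christoffel symbols, this rests on their transformation law
(`christoffelMap_pullback`), a consequence of the Koszul formula and the symmetry of second
derivatives.

Bijectivity is unique path lifting: the lift starting at the base point of `u'` is `C^r` because `q`
is locally invertible, and its terminal unit tangent selects the summand.

For continuity, a chart of `S` composed with a local restriction of `q` is a chart of `S'`; in such
a pair of charts `q` is the identity, so the derivative estimates upstairs and downstairs coincide
(`continuous_map`, `continuous_of_map_continuous`). The inverse needs two more facts: lifts depend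
jointly continuously on parameter and curve, so they stay on the right sheet, and the terminal
vector is locally constant because fibres of `q` are discrete. -/

noncomputable section

namespace CurveSpaces

open Topology Set Filter

/-! ### Christoffel symbols in the plane and their transformation law. -/

section PlanarConnection

/-- The bilinear form on the plane with matrix `A`. -/
def bilin (A : Matrix (Fin 2) (Fin 2) ℝ) (a b : Plane) : ℝ :=
  ∑ i, ∑ j, A i j * a i * b j

/-- The Christoffel symbols of a matrix-valued function on the plane. -/
def planeChristoffel (M : Plane → Matrix (Fin 2) (Fin 2) ℝ) (k i j : Fin 2) (y : Plane) : ℝ :=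
  (1 / 2 : ℝ) * ∑ l : Fin 2, (M y)⁻¹ k l *
    (fderiv ℝ (fun z => M z j l) y (stdVec i) + fderiv ℝ (fun z => M z i l) y (stdVec j) -
      fderiv ℝ (fun z => M z i j) y (stdVec l))

/-- The vector-valued bilinear map given by the Christoffel symbols. -/
def christoffelMap (M : Plane → Matrix (Fin 2) (Fin 2) ℝ) (y a b : Plane) : Plane :=
  WithLp.toLp 2 (fun k => ∑ i : Fin 2, ∑ j : Fin 2, planeChristoffel M k i j y * a i * b j)

lemma plane_eq_sum (a : Plane) : a = a 0 • stdVec 0 + a 1 • stdVec 1 := by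
  ext i
  fin_cases i <;> simp

lemma bilin_add_left (A : Matrix (Fin 2) (Fin 2) ℝ) (a b c : Plane) :
    bilin A (a + b) c = bilin A a c + bilin A b c := by
  simp only [bilin, Fin.sum_univ_two, PiLp.add_apply]; ring

lemma bilin_comm {A : Matrix (Fin 2) (Fin 2) ℝ} (hA : A.IsSymm) (a b : Plane) :
    bilin A a b = bilin A b a := by
  have h : A 1 0 = A 0 1 := hA.apply 0 1
  simp only [bilin, Fin.sum_univ_two, h]; ring

/-- Testing against the two basis vectors gives a linear system, solved by Cramer's rule. -/
lemma bilin_left_cancel {A : Matrix (Fin 2) (Fin 2) ℝ} (hA : A.det ≠ 0) {a b : Plane}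
    (h : ∀ c, bilin A a c = bilin A b c) : a = b := by
  have h0 := h (stdVec 0)
  have h1 := h (stdVec 1)
  simp [bilin, Fin.sum_univ_two] at h0 h1
  rw [Matrix.det_fin_two] at hA
  ext i
  fin_cases i
  · apply mul_left_cancel₀ hA
    simp only [Fin.zero_eta]
    linear_combination A 1 1 * h0 - A 1 0 * h1
  · apply mul_left_cancel₀ hA
    simp only [Fin.mk_one]
    linear_combination A 0 0 * h1 - A 0 1 * h0

lemma fderiv_bilin_apply {A : Plane → Matrix (Fin 2) (Fin 2) ℝ} {b c : Plane → Plane} {y : Plane}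
    (hA : ∀ i j, DifferentiableAt ℝ (fun z => A z i j) y) (hb : DifferentiableAt ℝ b y)
    (hc : DifferentiableAt ℝ c y) (a : Plane) :
    fderiv ℝ (fun z => bilin (A z) (b z) (c z)) y a =
      ∑ i, ∑ j, fderiv ℝ (fun z => A z i j) y a * b y i * c y j +
        bilin (A y) (fderiv ℝ b y a) (c y) + bilin (A y) (b y) (fderiv ℝ c y a) := by
  have hb' : ∀ i, HasFDerivAt (fun z => b z i)
      ((EuclideanSpace.proj i : Plane →L[ℝ] ℝ).comp (fderiv ℝ b y)) y := fun i =>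
    (EuclideanSpace.proj i : Plane →L[ℝ] ℝ).hasFDerivAt.comp y hb.hasFDerivAt
  have hc' : ∀ i, HasFDerivAt (fun z => c z i)
      ((EuclideanSpace.proj i : Plane →L[ℝ] ℝ).comp (fderiv ℝ c y)) y := fun i =>
    (EuclideanSpace.proj i : Plane →L[ℝ] ℝ).hasFDerivAt.comp y hc.hasFDerivAt
  have h := fun i j => ((hA i j).hasFDerivAt.fun_mul (hb' i)).fun_mul (hc' j)
  have h' := ((h 0 0).fun_add (h 0 1)).fun_add ((h 1 0).fun_add (h 1 1))
  simp only [bilin, Fin.sum_univ_two]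
  have hp : ∀ i (w : Plane), (EuclideanSpace.proj i : Plane →L[ℝ] ℝ) w = w i := fun _ _ => rfl
  rw [h'.fderiv]
  simp only [add_apply, smul_apply, smul_eq_mul, ContinuousLinearMap.comp_apply,
    hp]
  ring

lemma fderiv_bilin_const {M : Plane → Matrix (Fin 2) (Fin 2) ℝ} {y : Plane}
    (hM : ∀ i j, DifferentiableAt ℝ (fun z => M z i j) y) (a b c : Plane) :
    fderiv ℝ (fun z => bilin (M z) b c) y a =
      ∑ i, ∑ j, fderiv ℝ (fun z => M z i j) y a * b i * c j := by
  rw [fderiv_bilin_apply hM (differentiableAt_const b) (differentiableAt_const c)]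
  simp [bilin]

lemma fderiv_bilin {M : Plane → Matrix (Fin 2) (Fin 2) ℝ} {y : Plane}
    (hM : ∀ i j, DifferentiableAt ℝ (fun z => M z i j) y) (a b c : Plane) :
    fderiv ℝ (fun z => bilin (M z) b c) y a =
      ∑ l, ∑ i, ∑ j, fderiv ℝ (fun z => M z i j) y (stdVec l) * a l * b i * c j := by
  rw [fderiv_bilin_const hM]
  have e : ∀ i j, fderiv ℝ (fun z => M z i j) y a =
      a 0 * fderiv ℝ (fun z => M z i j) y (stdVec 0) +
        a 1 * fderiv ℝ (fun z => M z i j) y (stdVec 1) := by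
    intro i j
    conv_lhs => rw [plane_eq_sum a]
    rw [map_add, map_smul, map_smul, smul_eq_mul, smul_eq_mul]
  simp only [e, Fin.sum_univ_two]
  ring

/-- The Koszul formula. -/
lemma bilin_christoffelMap {M : Plane → Matrix (Fin 2) (Fin 2) ℝ} {y : Plane}
    (hM : ∀ i j, DifferentiableAt ℝ (fun z => M z i j) y) (hs : ∀ z, (M z).IsSymm)
    (hd : (M y).det ≠ 0) (a b c : Plane) :
    2 * bilin (M y) (christoffelMap M y a b) c =
      fderiv ℝ (fun z => bilin (M z) b c) y a + fderiv ℝ (fun z => bilin (M z) a c) y b -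
        fderiv ℝ (fun z => bilin (M z) a b) y c := by
  have hI : M y * (M y)⁻¹ = 1 := Matrix.mul_nonsing_inv _ (isUnit_iff_ne_zero.2 hd)
  have h00 := congrFun (congrFun hI 0) 0
  have h01 := congrFun (congrFun hI 0) 1
  have h10 := congrFun (congrFun hI 1) 0
  have h11 := congrFun (congrFun hI 1) 1
  have hsy : M y 1 0 = M y 0 1 := (hs y).apply 0 1
  have hsf : (fun z => M z 1 0) = fun z => M z 0 1 := funext fun z => (hs z).apply 0 1
  simp only [Matrix.mul_apply, Fin.sum_univ_two, Matrix.one_apply_eq, ne_eq, zero_ne_one,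
    one_ne_zero, not_false_eq_true, Matrix.one_apply_ne, hsy] at h00 h01 h10 h11
  rw [fderiv_bilin hM, fderiv_bilin hM, fderiv_bilin hM]
  -- Lowering the index cancels the inverse matrix and leaves the Christoffel symbols of the first
  -- kind.
  have key : ∀ l, 2 * ∑ k, M y l k * christoffelMap M y a b k = ∑ i, ∑ j,
      (fderiv ℝ (fun z => M z j l) y (stdVec i) + fderiv ℝ (fun z => M z i l) y (stdVec j) -
        fderiv ℝ (fun z => M z i j) y (stdVec l)) * a i * b j := by
    intro l
    simp only [christoffelMap, planeChristoffel, Fin.sum_univ_two]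
    revert l
    rw [Fin.forall_fin_two]
    -- With `plij` standing for `∂_l g_ij`, the claim is polynomial; the coefficients below are
    -- twice the first-kind symbols contracted with `a` and `b`.
    generalize fderiv ℝ (fun z => M z 0 0) y (stdVec 0) = p000
    generalize fderiv ℝ (fun z => M z 0 1) y (stdVec 0) = p001
    generalize fderiv ℝ (fun z => M z 1 0) y (stdVec 0) = p010
    generalize fderiv ℝ (fun z => M z 1 1) y (stdVec 0) = p011
    generalize fderiv ℝ (fun z => M z 0 0) y (stdVec 1) = p100
    generalize fderiv ℝ (fun z => M z 0 1) y (stdVec 1) = p101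
    generalize fderiv ℝ (fun z => M z 1 0) y (stdVec 1) = p110
    generalize fderiv ℝ (fun z => M z 1 1) y (stdVec 1) = p111
    constructor
    · linear_combination
        ((p000 + p000 - p000) * a 0 * b 0 + (p010 + p100 - p001) * a 0 * b 1 +
          (p100 + p010 - p010) * a 1 * b 0 + (p110 + p110 - p011) * a 1 * b 1) * h00 +
        ((p001 + p001 - p100) * a 0 * b 0 + (p011 + p101 - p101) * a 0 * b 1 +
          (p101 + p011 - p110) * a 1 * b 0 + (p111 + p111 - p111) * a 1 * b 1) * h01
    · rw [hsy]
      linear_combination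
        ((p000 + p000 - p000) * a 0 * b 0 + (p010 + p100 - p001) * a 0 * b 1 +
          (p100 + p010 - p010) * a 1 * b 0 + (p110 + p110 - p011) * a 1 * b 1) * h10 +
        ((p001 + p001 - p100) * a 0 * b 0 + (p011 + p101 - p101) * a 0 * b 1 +
          (p101 + p011 - p110) * a 1 * b 0 + (p111 + p111 - p111) * a 1 * b 1) * h11
  have k0 := key 0
  have k1 := key 1
  simp only [Fin.sum_univ_two, hsy, hsf] at k0 k1
  simp only [bilin, Fin.sum_univ_two, hsy, hsf]
  linear_combination c 0 * k0 + c 1 * k1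

/-- The transformation law of the Christoffel symbols under a change of coordinates. -/
lemma christoffelMap_pullback {M M' : Plane → Matrix (Fin 2) (Fin 2) ℝ} {F : Plane → Plane}
    {x : Plane} (hF : ContDiffAt ℝ 2 F x) (hsurj : Function.Surjective (fderiv ℝ F x))
    (hM : ∀ i j, DifferentiableAt ℝ (fun z => M z i j) (F x)) (hs : ∀ z, (M z).IsSymm)
    (hd : (M (F x)).det ≠ 0)
    (hM' : ∀ i j, DifferentiableAt ℝ (fun z => M' z i j) x) (hs' : ∀ z, (M' z).IsSymm)
    (hd' : (M' x).det ≠ 0)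
    (hMM' : ∀ᶠ z in nhds x, ∀ a b,
      bilin (M' z) a b = bilin (M (F z)) (fderiv ℝ F z a) (fderiv ℝ F z b)) (a b : Plane) :
    fderiv ℝ F x (christoffelMap M' x a b) = fderiv ℝ (fderiv ℝ F) x a b +
      christoffelMap M (F x) (fderiv ℝ F x a) (fderiv ℝ F x b) := by
  have hF1 : DifferentiableAt ℝ F x := hF.differentiableAt (by norm_num)
  have hF2 : DifferentiableAt ℝ (fderiv ℝ F) x :=
    (hF.fderiv_right (m := 1) (by norm_num)).differentiableAt (by norm_num)
  have hsymm : ∀ a b, fderiv ℝ (fderiv ℝ F) x a b = fderiv ℝ (fderiv ℝ F) x b a :=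
    (hF.isSymmSndFDerivAt (by simp)).eq
  -- Differentiating the pullback identity: one term from the metric, two from the second derivative
  -- of `F`.
  have hder : ∀ a b c, fderiv ℝ (fun z => bilin (M' z) b c) x a =
      fderiv ℝ (fun z => bilin (M z) (fderiv ℝ F x b) (fderiv ℝ F x c)) (F x) (fderiv ℝ F x a) +
        bilin (M (F x)) (fderiv ℝ (fderiv ℝ F) x a b) (fderiv ℝ F x c) +
        bilin (M (F x)) (fderiv ℝ F x b) (fderiv ℝ (fderiv ℝ F) x a c) := by
    intro a b c
    have he : (fun z => bilin (M' z) b c) =ᶠ[nhds x]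
        fun z => bilin (M (F z)) (fderiv ℝ F z b) (fderiv ℝ F z c) := by
      filter_upwards [hMM'] with z hz
      rw [hz]
    have h1 : ∀ i j, HasFDerivAt (fun z => M (F z) i j)
        ((fderiv ℝ (fun z => M z i j) (F x)).comp (fderiv ℝ F x)) x := fun i j =>
      HasFDerivAt.comp (g := fun z => M z i j) x (hM i j).hasFDerivAt hF1.hasFDerivAt
    have h2 : ∀ b, HasFDerivAt (fun z => fderiv ℝ F z b) ((fderiv ℝ (fderiv ℝ F) x).flip b) x := by
      intro b
      convert! hF2.hasFDerivAt.clm_apply (hasFDerivAt_const b x) using 1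
      ext1 a
      simp
    rw [he.fderiv_eq, fderiv_bilin_apply (fun i j => (h1 i j).differentiableAt)
      (h2 b).differentiableAt (h2 c).differentiableAt, fderiv_bilin_const hM, (h2 b).fderiv,
      (h2 c).fderiv]
    simp only [(h1 _ _).fderiv, ContinuousLinearMap.comp_apply, ContinuousLinearMap.flip_apply]
  apply bilin_left_cancel hd
  intro c
  obtain ⟨c, rfl⟩ := hsurj c
  rw [← hMM'.self_of_nhds, bilin_add_left]
  -- Of the six second-derivative terms in the Koszul formula for `M'`, symmetry cancels four and
  -- makes the other two equal to the pairing of `D²F(a, b)` with `dF c`.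
  have k' := bilin_christoffelMap hM' hs' hd' a b c
  have k := bilin_christoffelMap hM hs hd (fderiv ℝ F x a) (fderiv ℝ F x b) (fderiv ℝ F x c)
  rw [hder, hder, hder, hsymm b a, hsymm c a, hsymm c b] at k'
  rw [bilin_comm (hs (F x)) (fderiv ℝ F x b) (fderiv ℝ (fderiv ℝ F) x a c)] at k'
  rw [bilin_comm (hs (F x)) (fderiv ℝ F x a) (fderiv ℝ (fderiv ℝ F) x b c)] at k'
  linarith

/-- The derivative of `s ↦ dF (x s) (v s)`. -/
lemma hasDerivWithinAt_fderiv_apply {F : Plane → Plane} {x v : ℝ → Plane} {x' v' : Plane}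
    {s : Set ℝ} {t : ℝ} (hF : ContDiffAt ℝ 2 F (x t)) (hx : HasDerivWithinAt x x' s t)
    (hv : HasDerivWithinAt v v' s t) :
    HasDerivWithinAt (fun r => fderiv ℝ F (x r) (v r))
      (fderiv ℝ (fderiv ℝ F) (x t) x' (v t) + fderiv ℝ F (x t) v') s t := by
  have hF2 : DifferentiableAt ℝ (fderiv ℝ F) (x t) :=
    (hF.fderiv_right (m := 1) (by norm_num)).differentiableAt (by norm_num)
  exact (hF2.hasFDerivAt.comp_hasDerivWithinAt t hx).clm_apply hv

end PlanarConnection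

/-! ### The matrix of the metric in a chart: symmetry, nondegeneracy, differentiability. -/

section ChartMetric

variable {S : Type*} [TopologicalSpace S] [ChartedSpace Plane S] [IsManifold (𝓡 2) ∞ S]

lemma isManifold_one : IsManifold (𝓡 2) 1 S := IsManifold.of_le (n := ∞) (by norm_num)

omit [IsManifold (𝓡 2) ∞ S] in
lemma mdifferentiable_of_mem_maximalAtlas {φ : OpenPartialHomeomorph S Plane}
    (hφ : φ ∈ IsManifold.maximalAtlas (𝓡 2) ∞ S) : φ.MDifferentiable (𝓡 2) (𝓡 2) :=
  ⟨(contMDiffOn_of_mem_maximalAtlas hφ).mdifferentiableOn (by simp),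
    (contMDiffOn_symm_of_mem_maximalAtlas hφ).mdifferentiableOn (by simp)⟩

lemma isInvertible_mfderiv_chart {φ : OpenPartialHomeomorph S Plane}
    (hφ : φ ∈ IsManifold.maximalAtlas (𝓡 2) ∞ S) {x : S} (hx : x ∈ φ.source) :
    (mfderiv (𝓡 2) (𝓡 2) φ x).IsInvertible :=
  have : IsManifold (𝓡 2) 1 S := isManifold_one
  ⟨(mdifferentiable_of_mem_maximalAtlas hφ).mfderiv hx, rfl⟩

/-- The inner product of tangent vectors in terms of the model plane. -/
def SurfaceMetric.innerAt (g : SurfaceMetric S) (x : S) (a b : Plane) : ℝ :=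
  g.inner x a b

lemma bilin_metricMatrix (g : SurfaceMetric S) (φ : OpenPartialHomeomorph S Plane)
    (y a b : Plane) :
    bilin (metricMatrix g φ y) a b = g.inner (φ.symm y) (mfderiv (𝓡 2) (𝓡 2) φ.symm y a)
      (mfderiv (𝓡 2) (𝓡 2) φ.symm y b) := by
  have h : ∀ (L : Plane →L[ℝ] Plane) (B : Plane →L[ℝ] Plane →L[ℝ] ℝ), B (L a) (L b) =
      ∑ i, ∑ j, B (L (stdVec i)) (L (stdVec j)) * a i * b j := by
    intro L B
    conv_lhs => rw [plane_eq_sum a, plane_eq_sum b]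
    simp only [map_add, map_smul, add_apply, smul_apply, smul_eq_mul, Fin.sum_univ_two]
    ring
  exact (h (mfderiv (𝓡 2) (𝓡 2) φ.symm y) (g.inner (φ.symm y))).symm

lemma metricMatrix_isSymm (g : SurfaceMetric S) (φ : OpenPartialHomeomorph S Plane) (y : Plane) :
    (metricMatrix g φ y).IsSymm := by
  ext i j
  exact g.symm _ _ _

/-- A kernel vector would map to a tangent vector of length zero, although the differential of
`φ.symm` is injective and the metric is positive. -/
lemma det_metricMatrix_ne_zero (g : SurfaceMetric S) {φ : OpenPartialHomeomorph S Plane}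
    (hφ : φ ∈ IsManifold.maximalAtlas (𝓡 2) ∞ S) {y : Plane} (hy : y ∈ φ.target) :
    (metricMatrix g φ y).det ≠ 0 := by
  have : IsManifold (𝓡 2) 1 S := isManifold_one
  intro h
  obtain ⟨v, hv, hv0⟩ := Matrix.exists_mulVec_eq_zero_iff.2 h
  have h0 : bilin (metricMatrix g φ y) (WithLp.toLp 2 v) (WithLp.toLp 2 v) = 0 := by
    have e0 := congrFun hv0 0
    have e1 := congrFun hv0 1
    simp only [Matrix.mulVec, dotProduct, Fin.sum_univ_two, Pi.zero_apply] at e0 e1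
    simp only [bilin, Fin.sum_univ_two]
    linear_combination v 0 * e0 + v 1 * e1
  rw [bilin_metricMatrix] at h0
  have hinj := (mdifferentiable_of_mem_maximalAtlas hφ).symm.mfderiv_injective (x := y) hy
  have hz : mfderiv (𝓡 2) (𝓡 2) φ.symm y (WithLp.toLp 2 v) = 0 := by
    by_contra hne
    exact (g.pos _ _ hne).ne' h0
  rw [← map_zero (mfderiv (𝓡 2) (𝓡 2) φ.symm y)] at hz
  apply hv
  have h1 : (WithLp.toLp 2 v : Plane) = 0 := hinj hz
  ext i
  exact congrArg (fun w : Plane => w i) h1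

/-- The field is the tangent map of `φ.symm` along the constant section `z ↦ (z, a)`. Class `C¹`
suffices, since the metric matrix is differentiated only once. -/
lemma contMDiffAt_coordVec {φ : OpenPartialHomeomorph S Plane}
    (hφ : φ ∈ IsManifold.maximalAtlas (𝓡 2) ∞ S) {y : Plane} (hy : y ∈ φ.target) (a : Plane) :
    ContMDiffAt (𝓡 2) (𝓡 2).tangent 1 (fun z =>
      (⟨φ.symm z, mfderiv (𝓡 2) (𝓡 2) φ.symm z a⟩ : TangentBundle (𝓡 2) S)) y := by
  have : IsManifold (𝓡 2) 1 S := isManifold_one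
  have h1 : ContMDiffOn (𝓡 2) (𝓡 2) 2 φ.symm φ.target :=
    (contMDiffOn_symm_of_mem_maximalAtlas hφ).of_le (WithTop.coe_le_coe.2 le_top)
  have h2 := h1.contMDiffOn_tangentMapWithin (m := 1) (by norm_num)
    (φ.open_target.uniqueMDiffOn)
  have h3 : ContMDiff (𝓡 2) (𝓡 2).tangent 1
      (fun z : Plane => (⟨z, a⟩ : TangentBundle (𝓡 2) Plane)) := fun z =>
    contMDiffAt_vectorSpace_iff_contDiffAt.2 contDiffAt_const
  have h4 := h2.comp h3.contMDiffOn (s := φ.target) (fun z hz => hz)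
  refine (h4.contMDiffAt (φ.open_target.mem_nhds hy)).congr_of_eventuallyEq ?_
  filter_upwards [φ.open_target.mem_nhds hy] with z hz
  simp only [Function.comp, tangentMapWithin, mfderivWithin_of_isOpen φ.open_target hz]

/-- Each entry contracts the smooth metric section with two `C¹` coordinate fields. -/
lemma differentiableAt_metricMatrix (g : SurfaceMetric S) {φ : OpenPartialHomeomorph S Plane}
    (hφ : φ ∈ IsManifold.maximalAtlas (𝓡 2) ∞ S) {y : Plane} (hy : y ∈ φ.target) (i j : Fin 2) :
    DifferentiableAt ℝ (fun z => metricMatrix g φ z i j) y := by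
  have : IsManifold (𝓡 2) 1 S := isManifold_one
  have h : ContMDiffAt (𝓡 2) ((𝓡 2).prod 𝓘(ℝ)) 1
      (fun z => Bundle.TotalSpace.mk' ℝ (E := Bundle.Trivial S ℝ) (φ.symm z)
        (g.inner (φ.symm z) (mfderiv (𝓡 2) (𝓡 2) φ.symm z (stdVec i))
          (mfderiv (𝓡 2) (𝓡 2) φ.symm z (stdVec j)))) y := by
    apply ContMDiffAt.clm_bundle_apply₂ (F₁ := Plane) (F₂ := Plane)
    · exact ((g.contMDiff.of_le (by norm_num)).contMDiffAt).comp y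
        ((contMDiffAt_symm_of_mem_maximalAtlas hφ hy).of_le (by norm_num))
    · exact contMDiffAt_coordVec hφ hy (stdVec i)
    · exact contMDiffAt_coordVec hφ hy (stdVec j)
  rw [Bundle.contMDiffAt_totalSpace] at h
  exact (contMDiffAt_iff_contDiffAt.1 h.2).differentiableAt (by norm_num)

end ChartMetric

/-! ### Curves and their velocities in coordinates. -/

section CurveInChart

variable {S : Type*} [TopologicalSpace S] [ChartedSpace Plane S] [IsManifold (𝓡 2) ∞ S]

/-- The expression of a curve in a chart, as a function of a real parameter. -/
def coordCurve (φ : OpenPartialHomeomorph S Plane) (γ : unitInterval → S) (s : ℝ) : Plane :=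
  φ (γ (projIcc 0 1 zero_le_one s))

lemma coordCurve_coe (φ : OpenPartialHomeomorph S Plane) (γ : unitInterval → S)
    (t : unitInterval) : coordCurve φ γ t = φ (γ t) := by
  simp [coordCurve]

lemma components_coe (φ : OpenPartialHomeomorph S Plane) (γ : unitInterval → S)
    (V : ∀ t, TangentSpace (𝓡 2) (γ t)) (t : unitInterval) :
    components φ γ V t = mfderiv (𝓡 2) (𝓡 2) φ (γ t) (V t) := by
  have h : projIcc (0 : ℝ) 1 zero_le_one t = t := projIcc_val zero_le_one t
  unfold components
  rw [h]

omit [IsManifold (𝓡 2) ∞ S] in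
lemma eventually_mem_of_isOpen {γ : unitInterval → S} (hγ : Continuous γ) {U : Set S}
    (hU : IsOpen U) {t : unitInterval} (ht : γ t ∈ U) :
    ∀ᶠ s in 𝓝[Icc (0 : ℝ) 1] (t : ℝ), γ (projIcc 0 1 zero_le_one s) ∈ U := by
  have hc : ContinuousAt (fun s : ℝ => γ (projIcc 0 1 zero_le_one s)) (t : ℝ) :=
    (hγ.comp continuous_projIcc).continuousAt
  apply nhdsWithin_le_nhds
  apply hc.preimage_mem_nhds
  rw [projIcc_val]
  exact hU.mem_nhds ht

lemma contDiffWithinAt_coordCurve {φ : OpenPartialHomeomorph S Plane}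
    (hφ : φ ∈ IsManifold.maximalAtlas (𝓡 2) ∞ S) {γ : unitInterval → S} {n : WithTop ℕ∞}
    (hn : n ≤ ∞) {t : unitInterval} (hγ : ContMDiffAt (𝓡∂ 1) (𝓡 2) n γ t)
    (ht : γ t ∈ φ.source) : ContDiffWithinAt ℝ n (coordCurve φ γ) (Icc 0 1) t := by
  have h := ((contMDiffAt_of_mem_maximalAtlas hφ ht).of_le hn).comp t hγ
  exact (contMDiffWithinAt_comp_projIcc_iff.2 h).contDiffWithinAt

/-- The components of the velocity are the derivatives of the coordinates. -/
lemma hasDerivWithinAt_coordCurve {φ : OpenPartialHomeomorph S Plane}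
    (hφ : φ ∈ IsManifold.maximalAtlas (𝓡 2) ∞ S) {γ : unitInterval → S} {t : unitInterval}
    (hγ : ContMDiffAt (𝓡∂ 1) (𝓡 2) 1 γ t) (ht : γ t ∈ φ.source) :
    HasDerivWithinAt (coordCurve φ γ) (components φ γ (velocity γ) t) (Icc 0 1) t := by
  have hd := (contDiffWithinAt_coordCurve hφ (by norm_num) hγ ht).differentiableWithinAt
    (by norm_num)
  convert! hd.hasDerivWithinAt using 1
  rw [components_coe, ← fderivWithin_derivWithin, ← mfderivWithin_eq_fderivWithin]
  -- This passes from the unit vector of `[0,1]` as a manifold with boundary to the derivative in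
  -- the real parameter.
  have h := mfderivWithin_comp_projIcc_one (I := 𝓡 2) (f := φ ∘ γ) (w := t)
  have h' := mfderiv_comp t (contMDiffAt_of_mem_maximalAtlas hφ ht |>.mdifferentiableAt (by simp))
    (hγ.mdifferentiableAt one_ne_zero)
  rw [h'] at h
  exact h.symm

/-- Near `t` the components are the first derivative of the `C²` coordinate curve. This makes the
covariant derivative of the velocity accessible to `covDeriv_pushField`. -/
lemma differentiableWithinAt_components_velocity {φ : OpenPartialHomeomorph S Plane}
    (hφ : φ ∈ IsManifold.maximalAtlas (𝓡 2) ∞ S) {γ : unitInterval → S}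
    (hγ : ContMDiff (𝓡∂ 1) (𝓡 2) 2 γ) {t : unitInterval} (ht : γ t ∈ φ.source) :
    DifferentiableWithinAt ℝ (components φ γ (velocity γ)) (Icc 0 1) t := by
  have hu : UniqueDiffOn ℝ (Icc (0 : ℝ) 1) := uniqueDiffOn_Icc zero_lt_one
  have h := ((contDiffWithinAt_coordCurve hφ (WithTop.coe_le_coe.2 le_top) (hγ t) ht).derivWithin
    hu (m := 1) (by norm_num) t.2).differentiableWithinAt (by norm_num)
  have he : ∀ s : unitInterval, γ s ∈ φ.source →
      components φ γ (velocity γ) s = derivWithin (coordCurve φ γ) (Icc 0 1) s := fun s hs =>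
    ((hasDerivWithinAt_coordCurve hφ ((hγ s).of_le (by norm_num)) hs).derivWithin
      (hu s s.2)).symm
  refine h.congr_of_eventuallyEq ?_ (he t ht)
  filter_upwards [eventually_mem_of_isOpen hγ.continuous φ.open_source ht, self_mem_nhdsWithin]
    with s hs hsI
  rw [projIcc_of_mem _ hsI] at hs
  exact he ⟨s, hsI⟩ hs

end CurveInChart

/-! ### The coordinate expression of the covering and of its differential. -/

section Transition

variable {S' S : Type*}
  [TopologicalSpace S'] [ChartedSpace Plane S'] [IsManifold (𝓡 2) ∞ S']
  [TopologicalSpace S] [ChartedSpace Plane S] [IsManifold (𝓡 2) ∞ S]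

/-- The expression in charts of a map between surfaces. -/
def transition (q : S' → S) (ψ : OpenPartialHomeomorph S' Plane)
    (φ : OpenPartialHomeomorph S Plane) (z : Plane) : Plane :=
  φ (q (ψ.symm z))

variable {q : S' → S} {ψ : OpenPartialHomeomorph S' Plane} {φ : OpenPartialHomeomorph S Plane}

lemma contDiffAt_transition (hq : ContMDiff (𝓡 2) (𝓡 2) ∞ q)
    (hψ : ψ ∈ IsManifold.maximalAtlas (𝓡 2) ∞ S') (hφ : φ ∈ IsManifold.maximalAtlas (𝓡 2) ∞ S)
    {z : Plane} (hz : z ∈ ψ.target) (hz' : q (ψ.symm z) ∈ φ.source) :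
    ContDiffAt ℝ ∞ (transition q ψ φ) z := by
  have h1 := contMDiffAt_symm_of_mem_maximalAtlas hψ hz
  have h2 := (hq (ψ.symm z)).comp z h1
  exact ((contMDiffAt_of_mem_maximalAtlas hφ hz').comp z h2).contDiffAt

/-- Chain rule applied to `transition q ψ φ ∘ ψ = φ ∘ q` near `x`. -/
lemma fderiv_transition (hq : ContMDiff (𝓡 2) (𝓡 2) ∞ q)
    (hψ : ψ ∈ IsManifold.maximalAtlas (𝓡 2) ∞ S') (hφ : φ ∈ IsManifold.maximalAtlas (𝓡 2) ∞ S)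
    {x : S'} (hx : x ∈ ψ.source) (hx' : q x ∈ φ.source) (w : TangentSpace (𝓡 2) x) :
    fderiv ℝ (transition q ψ φ) (ψ x) (mfderiv (𝓡 2) (𝓡 2) ψ x w) =
      mfderiv (𝓡 2) (𝓡 2) φ (q x) (mfderiv (𝓡 2) (𝓡 2) q x w) := by
  have hz : q (ψ.symm (ψ x)) ∈ φ.source := by rwa [ψ.left_inv hx]
  have hT : MDifferentiableAt (𝓡 2) (𝓡 2) (transition q ψ φ) (ψ x) :=
    ((contDiffAt_transition hq hψ hφ (ψ.map_source hx) hz).differentiableAt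
      (by simp)).mdifferentiableAt
  have hψx : MDifferentiableAt (𝓡 2) (𝓡 2) ψ x :=
    (contMDiffAt_of_mem_maximalAtlas hψ hx).mdifferentiableAt (by simp)
  have hqx : MDifferentiableAt (𝓡 2) (𝓡 2) q x := (hq x).mdifferentiableAt (by simp)
  have hφx : MDifferentiableAt (𝓡 2) (𝓡 2) φ (q x) :=
    (contMDiffAt_of_mem_maximalAtlas hφ hx').mdifferentiableAt (by simp)
  have e : transition q ψ φ ∘ ψ =ᶠ[𝓝 x] φ ∘ q := by
    filter_upwards [ψ.open_source.mem_nhds hx] with y hy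
    simp [transition, ψ.left_inv hy]
  have h1 := mfderiv_comp x hT hψx
  have h2 := mfderiv_comp x hφx hqx
  rw [e.mfderiv_eq, h2, mfderiv_eq_fderiv] at h1
  exact (DFunLike.congr_fun h1 w).symm

variable {g' : SurfaceMetric S'} {g : SurfaceMetric S}

lemma IsRiemannianCovering.contMDiff (hq : IsRiemannianCovering g' g q) :
    ContMDiff (𝓡 2) (𝓡 2) ∞ q := hq.isLocalDiffeomorph.contMDiff

lemma IsRiemannianCovering.isInvertible (hq : IsRiemannianCovering g' g q) (x : S') :
    (mfderiv (𝓡 2) (𝓡 2) q x).IsInvertible :=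
  ⟨(hq.isLocalDiffeomorph x).mfderivToContinuousLinearEquiv (by simp), rfl⟩

lemma isInvertible_fderiv_transition (hq : IsRiemannianCovering g' g q)
    (hψ : ψ ∈ IsManifold.maximalAtlas (𝓡 2) ∞ S') (hφ : φ ∈ IsManifold.maximalAtlas (𝓡 2) ∞ S)
    {x : S'} (hx : x ∈ ψ.source) (hx' : q x ∈ φ.source) :
    (fderiv ℝ (transition q ψ φ) (ψ x)).IsInvertible := by
  have h1 := (isInvertible_mfderiv_chart hφ hx').comp (hq.isInvertible x)
  have h2 := isInvertible_mfderiv_chart hψ hx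
  have e : fderiv ℝ (transition q ψ φ) (ψ x) = ((mfderiv (𝓡 2) (𝓡 2) φ (q x)).comp
      (mfderiv (𝓡 2) (𝓡 2) q x)).comp (mfderiv (𝓡 2) (𝓡 2) ψ x).inverse := by
    ext1 w
    have h := fderiv_transition hq.contMDiff hψ hφ hx hx' ((mfderiv (𝓡 2) (𝓡 2) ψ x).inverse w)
    exact (congrArg (fderiv ℝ (transition q ψ φ) (ψ x)) (h2.self_apply_inverse w)).symm.trans h
  rw [e]
  exact h1.comp h2.inverse

/-- In charts, a local isometry pulls back the metric. -/
lemma bilin_metricMatrix_transition (hq : IsRiemannianCovering g' g q)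
    (hψ : ψ ∈ IsManifold.maximalAtlas (𝓡 2) ∞ S') (hφ : φ ∈ IsManifold.maximalAtlas (𝓡 2) ∞ S)
    {z : Plane} (hz : z ∈ ψ.target) (hz' : q (ψ.symm z) ∈ φ.source) (a b : Plane) :
    bilin (metricMatrix g' ψ z) a b = bilin (metricMatrix g φ (transition q ψ φ z))
      (fderiv ℝ (transition q ψ φ) z a) (fderiv ℝ (transition q ψ φ) z b) := by
  have : IsManifold (𝓡 2) 1 S := isManifold_one
  have : IsManifold (𝓡 2) 1 S' := isManifold_one
  have key : ∀ a : Plane, mfderiv (𝓡 2) (𝓡 2) φ.symm (transition q ψ φ z)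
      (fderiv ℝ (transition q ψ φ) z a) =
        mfderiv (𝓡 2) (𝓡 2) q (ψ.symm z) (mfderiv (𝓡 2) (𝓡 2) ψ.symm z a) := by
    intro a
    have h := fderiv_transition hq.contMDiff hψ hφ (ψ.map_target hz) hz'
      (mfderiv (𝓡 2) (𝓡 2) ψ.symm z a)
    have h1 := DFunLike.congr_fun
      ((mdifferentiable_of_mem_maximalAtlas hψ).comp_symm_deriv hz) a
    have h2 := DFunLike.congr_fun ((mdifferentiable_of_mem_maximalAtlas hφ).symm_comp_deriv hz')
      (mfderiv (𝓡 2) (𝓡 2) q (ψ.symm z) (mfderiv (𝓡 2) (𝓡 2) ψ.symm z a))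
    rw [ψ.right_inv hz] at h
    have h3 : fderiv ℝ (transition q ψ φ) z a = mfderiv (𝓡 2) (𝓡 2) φ (q (ψ.symm z))
        (mfderiv (𝓡 2) (𝓡 2) q (ψ.symm z) (mfderiv (𝓡 2) (𝓡 2) ψ.symm z a)) :=
      (congrArg (fderiv ℝ (transition q ψ φ) z) h1).symm.trans h
    exact (congrArg (mfderiv (𝓡 2) (𝓡 2) φ.symm (transition q ψ φ z)) h3).trans h2
  rw [bilin_metricMatrix, bilin_metricMatrix, key a, key b, ← hq.isometry]
  -- Tangent spaces depend on the base point; viewing the vectors in the model plane allows the base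
  -- point to be rewritten.
  change g.innerAt _ _ _ = g.innerAt _ _ _
  rw [transition, φ.left_inv hz']

end Transition

/-! ### Local isometries and covariant differentiation, parallelism, curvature. -/

section PushForward

variable {S' S : Type*}
  [TopologicalSpace S'] [ChartedSpace Plane S'] [IsManifold (𝓡 2) ∞ S']
  [TopologicalSpace S] [ChartedSpace Plane S] [IsManifold (𝓡 2) ∞ S]
  {q : S' → S} {ψ : OpenPartialHomeomorph S' Plane} {φ : OpenPartialHomeomorph S Plane}
  {g' : SurfaceMetric S'} {g : SurfaceMetric S}

/-- The image under `dq` of a vector field along a curve. -/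
def pushField (q : S' → S) (γ : unitInterval → S') (V : ∀ t, TangentSpace (𝓡 2) (γ t))
    (t : unitInterval) : TangentSpace (𝓡 2) (q (γ t)) :=
  mfderiv (𝓡 2) (𝓡 2) q (γ t) (V t)

lemma velocity_comp (hq : ContMDiff (𝓡 2) (𝓡 2) ∞ q) {γ : unitInterval → S'}
    (hγ : ContMDiff (𝓡∂ 1) (𝓡 2) 1 γ) :
    velocity (fun t => q (γ t)) = pushField q γ (velocity γ) := by
  funext t
  exact DFunLike.congr_fun (mfderiv_comp t ((hq (γ t)).mdifferentiableAt (by simp))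
    ((hγ t).mdifferentiableAt one_ne_zero)) 1

lemma components_pushField (hq : ContMDiff (𝓡 2) (𝓡 2) ∞ q)
    (hψ : ψ ∈ IsManifold.maximalAtlas (𝓡 2) ∞ S') (hφ : φ ∈ IsManifold.maximalAtlas (𝓡 2) ∞ S)
    {γ : unitInterval → S'} (V : ∀ t, TangentSpace (𝓡 2) (γ t)) {s : ℝ}
    (hs : γ (projIcc 0 1 zero_le_one s) ∈ ψ.source)
    (hs' : q (γ (projIcc 0 1 zero_le_one s)) ∈ φ.source) :
    components φ (fun t => q (γ t)) (pushField q γ V) s =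
      fderiv ℝ (transition q ψ φ) (coordCurve ψ γ s) (components ψ γ V s) :=
  (fderiv_transition hq hψ hφ hs hs' _).symm

lemma components_pushField_eventuallyEq (hq : ContMDiff (𝓡 2) (𝓡 2) ∞ q)
    (hψ : ψ ∈ IsManifold.maximalAtlas (𝓡 2) ∞ S') (hφ : φ ∈ IsManifold.maximalAtlas (𝓡 2) ∞ S)
    {γ : unitInterval → S'} (hγ : Continuous γ) (V : ∀ t, TangentSpace (𝓡 2) (γ t))
    {t : unitInterval} (ht : γ t ∈ ψ.source) (ht' : q (γ t) ∈ φ.source) :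
    components φ (fun t => q (γ t)) (pushField q γ V) =ᶠ[𝓝[Icc (0 : ℝ) 1] (t : ℝ)]
      fun s => fderiv ℝ (transition q ψ φ) (coordCurve ψ γ s) (components ψ γ V s) := by
  filter_upwards [eventually_mem_of_isOpen hγ ψ.open_source ht,
    eventually_mem_of_isOpen hγ (φ.open_source.preimage hq.continuous) ht'] with s h1 h2
  exact components_pushField hq hψ hφ V h1 h2

/-- The second-derivative term produced here is the inhomogeneous term in the transformation law of
the Christoffel symbols. -/
lemma hasDerivWithinAt_components_pushField (hq : ContMDiff (𝓡 2) (𝓡 2) ∞ q)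
    (hψ : ψ ∈ IsManifold.maximalAtlas (𝓡 2) ∞ S') (hφ : φ ∈ IsManifold.maximalAtlas (𝓡 2) ∞ S)
    {γ : unitInterval → S'} (hγ : ContMDiff (𝓡∂ 1) (𝓡 2) 1 γ)
    {V : ∀ t, TangentSpace (𝓡 2) (γ t)}
    {t : unitInterval} (ht : γ t ∈ ψ.source) (ht' : q (γ t) ∈ φ.source)
    (hV : DifferentiableWithinAt ℝ (components ψ γ V) (Icc 0 1) t) :
    HasDerivWithinAt (components φ (fun t => q (γ t)) (pushField q γ V))
      (fderiv ℝ (fderiv ℝ (transition q ψ φ)) (ψ (γ t)) (components ψ γ (velocity γ) t)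
          (components ψ γ V t) +
        fderiv ℝ (transition q ψ φ) (ψ (γ t)) (derivWithin (components ψ γ V) (Icc 0 1) t))
      (Icc 0 1) t := by
  have hF : ContDiffAt ℝ 2 (transition q ψ φ) (coordCurve ψ γ t) := by
    rw [coordCurve_coe]
    refine (contDiffAt_transition hq hψ hφ (ψ.map_source ht) ?_).of_le
      (WithTop.coe_le_coe.2 le_top)
    rwa [ψ.left_inv ht]
  have h := hasDerivWithinAt_fderiv_apply hF (hasDerivWithinAt_coordCurve hψ (hγ t) ht)
    hV.hasDerivWithinAt
  rw [coordCurve_coe] at h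
  refine h.congr_of_eventuallyEq
    (components_pushField_eventuallyEq hq hψ hφ hγ.continuous V ht ht') ?_
  exact (components_pushField_eventuallyEq hq hψ hφ hγ.continuous V ht ht').self_of_nhdsWithin t.2

/-- A local isometry commutes with covariant differentiation, in charts. -/
lemma covDerivComponents_pushField (hq : IsRiemannianCovering g' g q)
    (hψ : ψ ∈ IsManifold.maximalAtlas (𝓡 2) ∞ S') (hφ : φ ∈ IsManifold.maximalAtlas (𝓡 2) ∞ S)
    {γ : unitInterval → S'} (hγ : ContMDiff (𝓡∂ 1) (𝓡 2) 1 γ)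
    {V : ∀ t, TangentSpace (𝓡 2) (γ t)}
    {t : unitInterval} (ht : γ t ∈ ψ.source) (ht' : q (γ t) ∈ φ.source)
    (hV : DifferentiableWithinAt ℝ (components ψ γ V) (Icc 0 1) t) :
    covDerivComponents g φ (fun t => q (γ t)) (pushField q γ V) t =
      fderiv ℝ (transition q ψ φ) (ψ (γ t)) (covDerivComponents g' ψ γ V t) := by
  have hp : projIcc (0 : ℝ) 1 zero_le_one t = t := projIcc_val zero_le_one t
  have hz : ψ.symm (ψ (γ t)) = γ t := ψ.left_inv ht
  have hT : transition q ψ φ (ψ (γ t)) = φ (q (γ t)) := by rw [transition, hz]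
  have hmem : ∀ᶠ z in 𝓝 (ψ (γ t)), z ∈ ψ.target ∧ q (ψ.symm z) ∈ φ.source := by
    refine (ψ.open_target.eventually_mem (ψ.map_source ht)).and ?_
    refine (hq.contMDiff.continuous.continuousAt.comp
      (ψ.continuousAt_symm (ψ.map_source ht))).preimage_mem_nhds (φ.open_source.mem_nhds ?_)
    simpa [Function.comp, hz] using ht'
  have hφT : transition q ψ φ (ψ (γ t)) ∈ φ.target := hT ▸ φ.map_source ht'
  have hd := christoffelMap_pullback (M := metricMatrix g φ) (M' := metricMatrix g' ψ)
    (F := transition q ψ φ) (x := ψ (γ t))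
    ((contDiffAt_transition hq.contMDiff hψ hφ (ψ.map_source ht) (by rwa [hz])).of_le
      (WithTop.coe_le_coe.2 le_top))
    (isInvertible_fderiv_transition hq hψ hφ ht ht').surjective
    (fun i j => differentiableAt_metricMatrix g hφ hφT i j)
    (metricMatrix_isSymm g φ) (det_metricMatrix_ne_zero g hφ hφT)
    (fun i j => differentiableAt_metricMatrix g' hψ (ψ.map_source ht) i j)
    (metricMatrix_isSymm g' ψ) (det_metricMatrix_ne_zero g' hψ (ψ.map_source ht))
    (hmem.mono fun z hz a b => bilin_metricMatrix_transition hq hψ hφ hz.1 hz.2 a b)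
    (components ψ γ (velocity γ) t) (components ψ γ V t)
  have hc : ∀ W : ∀ t, TangentSpace (𝓡 2) (γ t),
      components φ (fun t => q (γ t)) (pushField q γ W) t =
        fderiv ℝ (transition q ψ φ) (ψ (γ t)) (components ψ γ W t) := by
    intro W
    rw [components_pushField hq.contMDiff hψ hφ W (by rwa [hp]) (by rwa [hp]), coordCurve_coe]
  have hu : UniqueDiffWithinAt ℝ (Icc (0 : ℝ) 1) t := uniqueDiffOn_Icc zero_lt_one _ t.2
  -- By definition the covariant derivative is the ordinary one plus `christoffelMap` of the metric
  -- matrix, so `hd` applies.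
  have e1 : ∀ W : ∀ t, TangentSpace (𝓡 2) (γ t), covDerivComponents g' ψ γ W t =
      derivWithin (components ψ γ W) (Icc 0 1) t + christoffelMap (metricMatrix g' ψ) (ψ (γ t))
        (components ψ γ (velocity γ) t) (components ψ γ W t) := fun W => rfl
  have e2 : covDerivComponents g φ (fun t => q (γ t)) (pushField q γ V) t =
      derivWithin (components φ (fun t => q (γ t)) (pushField q γ V)) (Icc 0 1) t +
        christoffelMap (metricMatrix g φ) (φ (q (γ t)))
        (components φ (fun t => q (γ t)) (velocity (fun t => q (γ t))) t)
        (components φ (fun t => q (γ t)) (pushField q γ V) t) := rfl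
  rw [e1, e2, velocity_comp hq.contMDiff hγ, hc, hc, map_add, hd, hT,
    (hasDerivWithinAt_components_pushField hq.contMDiff hψ hφ hγ ht ht' hV).derivWithin hu]
  abel

/-- A local isometry commutes with covariant differentiation. -/
lemma covDeriv_pushField (hq : IsRiemannianCovering g' g q)
    {γ : unitInterval → S'} (hγ : ContMDiff (𝓡∂ 1) (𝓡 2) 1 γ)
    {V : ∀ t, TangentSpace (𝓡 2) (γ t)} {t : unitInterval}
    (hV : DifferentiableWithinAt ℝ (components (chartAt Plane (γ t)) γ V) (Icc 0 1) t) :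
    covDeriv g (fun t => q (γ t)) (pushField q γ V) t =
      mfderiv (𝓡 2) (𝓡 2) q (γ t) (covDeriv g' γ V t) := by
  have hψ : chartAt Plane (γ t) ∈ IsManifold.maximalAtlas (𝓡 2) ∞ S' :=
    IsManifold.chart_mem_maximalAtlas _
  have hφ : chartAt Plane (q (γ t)) ∈ IsManifold.maximalAtlas (𝓡 2) ∞ S :=
    IsManifold.chart_mem_maximalAtlas _
  have ht := mem_chart_source Plane (γ t)
  have ht' := mem_chart_source Plane (q (γ t))
  have h1 := isInvertible_mfderiv_chart hψ ht
  have h2 := isInvertible_mfderiv_chart hφ ht'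
  apply h2.injective
  refine (h2.self_apply_inverse _).trans ?_
  rw [covDerivComponents_pushField hq hψ hφ hγ ht ht' hV]
  refine Eq.trans ?_ (fderiv_transition hq.contMDiff hψ hφ ht ht' _)
  exact congrArg _ (h1.self_apply_inverse _).symm

/-- The components of `V` are recovered by applying the inverse of the differential of the
transition map, and inversion of linear maps is differentiable. Needed to bring parallel fields from
`S` back to `S'`. -/
lemma differentiableWithinAt_components_of_pushField (hq : IsRiemannianCovering g' g q)
    (hψ : ψ ∈ IsManifold.maximalAtlas (𝓡 2) ∞ S') (hφ : φ ∈ IsManifold.maximalAtlas (𝓡 2) ∞ S)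
    {γ : unitInterval → S'} (hγ : ContMDiff (𝓡∂ 1) (𝓡 2) 1 γ)
    {V : ∀ t, TangentSpace (𝓡 2) (γ t)}
    {t : unitInterval} (ht : γ t ∈ ψ.source) (ht' : q (γ t) ∈ φ.source)
    (hV : DifferentiableWithinAt ℝ (components φ (fun t => q (γ t)) (pushField q γ V))
      (Icc 0 1) t) :
    DifferentiableWithinAt ℝ (components ψ γ V) (Icc 0 1) t := by
  have hF : ContDiffAt ℝ 2 (transition q ψ φ) (coordCurve ψ γ t) := by
    rw [coordCurve_coe]
    refine (contDiffAt_transition hq.contMDiff hψ hφ (ψ.map_source ht) ?_).of_le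
      (WithTop.coe_le_coe.2 le_top)
    rwa [ψ.left_inv ht]
  have hF2 : DifferentiableAt ℝ (fderiv ℝ (transition q ψ φ)) (coordCurve ψ γ t) :=
    (hF.fderiv_right (m := 1) (by norm_num)).differentiableAt (by norm_num)
  have hx := (hasDerivWithinAt_coordCurve hψ (hγ t) ht).differentiableWithinAt
  obtain ⟨e, he⟩ := isInvertible_fderiv_transition hq hψ hφ ht ht'
  have hinv : DifferentiableAt ℝ ContinuousLinearMap.inverse
      (fderiv ℝ (transition q ψ φ) (coordCurve ψ γ t)) := by
    rw [coordCurve_coe, ← he]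
    exact (contDiffAt_map_inverse (n := 1) e).differentiableAt (by norm_num)
  have hD : DifferentiableWithinAt ℝ
      (fun s => (fderiv ℝ (transition q ψ φ) (coordCurve ψ γ s)).inverse
        (components φ (fun t => q (γ t)) (pushField q γ V) s)) (Icc 0 1) t :=
    (hinv.comp_differentiableWithinAt (t : ℝ)
      (hF2.comp_differentiableWithinAt (t : ℝ) hx)).clm_apply hV
  have heq : components ψ γ V =ᶠ[𝓝[Icc (0 : ℝ) 1] (t : ℝ)]
      (fun s => (fderiv ℝ (transition q ψ φ) (coordCurve ψ γ s)).inverse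
        (components φ (fun t => q (γ t)) (pushField q γ V) s)) := by
    filter_upwards [eventually_mem_of_isOpen hγ.continuous ψ.open_source ht,
      eventually_mem_of_isOpen hγ.continuous
        (φ.open_source.preimage hq.contMDiff.continuous) ht'] with s h1 h2
    rw [components_pushField hq.contMDiff hψ hφ V h1 h2]
    exact ((isInvertible_fderiv_transition hq hψ hφ h1 h2).inverse_apply_self _).symm
  exact hD.congr_of_eventuallyEq heq (heq.self_of_nhdsWithin t.2)

lemma isParallel_pushField_iff (hq : IsRiemannianCovering g' g q)
    {γ : unitInterval → S'} (hγ : ContMDiff (𝓡∂ 1) (𝓡 2) 1 γ)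
    {V : ∀ t, TangentSpace (𝓡 2) (γ t)} :
    IsParallel g (fun t => q (γ t)) (pushField q γ V) ↔ IsParallel g' γ V := by
  have hψ : ∀ t, chartAt Plane (γ t) ∈ IsManifold.maximalAtlas (𝓡 2) ∞ S' := fun t =>
    IsManifold.chart_mem_maximalAtlas _
  have hφ : ∀ t, chartAt Plane (q (γ t)) ∈ IsManifold.maximalAtlas (𝓡 2) ∞ S := fun t =>
    IsManifold.chart_mem_maximalAtlas _
  have ht := fun t => mem_chart_source Plane (γ t)
  have ht' := fun t => mem_chart_source Plane (q (γ t))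
  refine forall_congr' fun t => ?_
  constructor
  · rintro ⟨h1, h2⟩
    have h3 := differentiableWithinAt_components_of_pushField hq (hψ t) (hφ t) hγ (ht t) (ht' t) h1
    refine ⟨h3, (hq.isInvertible (γ t)).injective ?_⟩
    rw [← covDeriv_pushField hq hγ h3, h2, map_zero]
  · rintro ⟨h1, h2⟩
    refine ⟨(hasDerivWithinAt_components_pushField hq.contMDiff (hψ t) (hφ t) hγ (ht t) (ht' t)
      h1).differentiableWithinAt, ?_⟩
    rw [covDeriv_pushField hq hγ h1, h2, map_zero]

/-- Lets the existential quantifiers over fields in `IsUnitNormal` and `IsAdmissible` be pulled back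
to `S'`. -/
lemma exists_pushField_eq (hq : IsRiemannianCovering g' g q) {γ : unitInterval → S'}
    (W : ∀ t, TangentSpace (𝓡 2) (q (γ t))) :
    ∃ V : ∀ t, TangentSpace (𝓡 2) (γ t), pushField q γ V = W := by
  choose V hV using fun t => (hq.isInvertible (γ t)).surjective (W t)
  exact ⟨V, funext hV⟩

lemma inner_pushField (hq : IsRiemannianCovering g' g q) {γ : unitInterval → S'}
    (V W : ∀ t, TangentSpace (𝓡 2) (γ t)) (t : unitInterval) :
    g.inner (q (γ t)) (pushField q γ V t) (pushField q γ W t) = g'.inner (γ t) (V t) (W t) :=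
  hq.isometry _ _ _

lemma unitTangent_comp (hq : IsRiemannianCovering g' g q) {γ : unitInterval → S'}
    (hγ : ContMDiff (𝓡∂ 1) (𝓡 2) 1 γ) :
    unitTangent g (fun t => q (γ t)) = pushField q γ (unitTangent g' γ) := by
  funext t
  simp only [unitTangent, velocity_comp hq.contMDiff hγ, inner_pushField hq]
  exact (map_smul (mfderiv (𝓡 2) (𝓡 2) q (γ t)) _ _).symm

lemma curvature_comp (hq : IsRiemannianCovering g' g q) {γ : unitInterval → S'}
    (hγ : ContMDiff (𝓡∂ 1) (𝓡 2) 2 γ) (N : ∀ t, TangentSpace (𝓡 2) (γ t)) (t : unitInterval) :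
    curvature g (fun t => q (γ t)) (pushField q γ N) t = curvature g' γ N t := by
  have hγ1 : ContMDiff (𝓡∂ 1) (𝓡 2) 1 γ := hγ.of_le (by norm_num)
  have h := covDeriv_pushField hq hγ1 (V := velocity γ) (t := t)
    (differentiableWithinAt_components_velocity (IsManifold.chart_mem_maximalAtlas _) hγ
      (mem_chart_source Plane (γ t)))
  simp only [curvature, velocity_comp hq.contMDiff hγ1, h]
  exact congrArg₂ (· / ·) (hq.isometry _ _ _) (hq.isometry _ _ _)

end PushForward

/-! ### The basis with its first vector reversed. -/

section Basis

variable {E : Type*} [AddCommGroup E] [Module ℝ E]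

lemma unitsSMul_neg_zero (e : Module.Basis (Fin 2) ℝ E) :
    e.unitsSMul (Function.update 1 0 (-1)) 0 = -e 0 := by
  simp [Module.Basis.unitsSMul_apply]

lemma unitsSMul_neg_one (e : Module.Basis (Fin 2) ℝ E) :
    e.unitsSMul (Function.update 1 0 (-1)) 1 = e 1 := by
  simp [Module.Basis.unitsSMul_apply]

end Basis

/-! ### Orientation, unit normal and admissibility under the covering. -/

section Admissible

variable {S' S : Type*}
  [TopologicalSpace S'] [ChartedSpace Plane S'] [IsManifold (𝓡 2) ∞ S']
  [TopologicalSpace S] [ChartedSpace Plane S] [IsManifold (𝓡 2) ∞ S]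
  {q : S' → S} {g' : SurfaceMetric S'} {g : SurfaceMetric S}

lemma isPositiveBasis_iff {p : S} {o : Orientation ℝ (TangentSpace (𝓡 2) p) (Fin 2)}
    {a b : TangentSpace (𝓡 2) p} :
    IsPositiveBasis o ⟨p, a⟩ ⟨p, b⟩ ↔
      ∃ e : Module.Basis (Fin 2) ℝ (TangentSpace (𝓡 2) p),
        a = e 0 ∧ b = e 1 ∧ e.orientation = o := by
  simp only [IsPositiveBasis, Bundle.TotalSpace.mk_inj]

/-- For the converse of `ho`: if `(a, b)` were a negative basis, then `(-a, b)` would be positive,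
so its image would be positive together with that of `(a, b)`; but these two images have opposite
orientations. -/
lemma isPositiveBasis_tangentMap_iff (hq : IsRiemannianCovering g' g q) {p' : S'} {p : S}
    (hp : q p' = p) {o' : Orientation ℝ (TangentSpace (𝓡 2) p') (Fin 2)}
    {o : Orientation ℝ (TangentSpace (𝓡 2) p) (Fin 2)} (ho : PreservesOrientation q o' o)
    (a b : TangentSpace (𝓡 2) p') :
    IsPositiveBasis o (tangentMap (𝓡 2) (𝓡 2) q ⟨p', a⟩) (tangentMap (𝓡 2) (𝓡 2) q ⟨p', b⟩) ↔
      IsPositiveBasis o' ⟨p', a⟩ ⟨p', b⟩ := by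
  subst hp
  refine ⟨fun h => ?_, ho a b⟩
  obtain ⟨L, hL⟩ := hq.isInvertible p'
  have hLa : ∀ w, mfderiv (𝓡 2) (𝓡 2) q p' w = L w := fun w => by rw [← hL]; rfl
  simp only [tangentMap, isPositiveBasis_iff, hLa] at h
  obtain ⟨e, h0, h1, hor⟩ := h
  have h0' : a = (e.map L.toLinearEquiv.symm) 0 := by
    rw [Module.Basis.map_apply, ← h0]; exact (L.symm_apply_apply a).symm
  have h1' : b = (e.map L.toLinearEquiv.symm) 1 := by
    rw [Module.Basis.map_apply, ← h1]; exact (L.symm_apply_apply b).symm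
  rw [isPositiveBasis_iff]
  rcases Module.Basis.orientation_eq_or_eq_neg (e.map L.toLinearEquiv.symm) o' with h | h
  · exact ⟨_, h0', h1', h.symm⟩
  · exfalso
    have h2 := (e.map L.toLinearEquiv.symm).orientation_neg_single 0
    rw [← h] at h2
    have h3 := ho (-a) b (isPositiveBasis_iff.2 ⟨_, by rw [unitsSMul_neg_zero, ← h0'],
      by rw [unitsSMul_neg_one, ← h1'], h2⟩)
    simp only [tangentMap, isPositiveBasis_iff, hLa, map_neg] at h3
    obtain ⟨f, hf0, hf1, hfo⟩ := h3
    have hfe : f = e.unitsSMul (Function.update 1 0 (-1)) := by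
      refine Module.Basis.eq_of_apply_eq fun i => ?_
      fin_cases i
      · exact (hf0.symm.trans (congrArg (-·) h0)).trans (unitsSMul_neg_zero e).symm
      · exact (hf1.symm.trans h1).trans (unitsSMul_neg_one e).symm
    rw [hfe, Module.Basis.orientation_neg_single, hor] at hfo
    exact Module.Ray.ne_neg_self o hfo.symm

/-- The parallel fields witnessing positivity are pushed forward or pulled back, so only
orientations at the initial point are compared. -/
lemma isUnitNormal_pushField_iff (hq : IsRiemannianCovering g' g q) {p' : S'} {p : S}
    (hp : q p' = p) {o' : Orientation ℝ (TangentSpace (𝓡 2) p') (Fin 2)}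
    {o : Orientation ℝ (TangentSpace (𝓡 2) p) (Fin 2)} (ho : PreservesOrientation q o' o)
    {γ : unitInterval → S'} (hγ : ContMDiff (𝓡∂ 1) (𝓡 2) 1 γ) (h0 : γ 0 = p')
    (N : ∀ t, TangentSpace (𝓡 2) (γ t)) :
    IsUnitNormal g o (fun t => q (γ t)) (pushField q γ N) ↔ IsUnitNormal g' o' γ N := by
  subst h0
  have hinj : ∀ (V W : ∀ t, TangentSpace (𝓡 2) (γ t)) (t : unitInterval),
      pushField q γ V t = pushField q γ W t ↔ V t = W t := fun V W t =>
    (hq.isInvertible (γ t)).injective.eq_iff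
  refine forall_congr' fun t => ?_
  rw [unitTangent_comp hq hγ, inner_pushField hq, inner_pushField hq]
  refine and_congr Iff.rfl (and_congr Iff.rfl ?_)
  constructor
  · rintro ⟨A, B, hA, hB, hAt, hBt, hAB⟩
    obtain ⟨A, rfl⟩ := exists_pushField_eq hq A
    obtain ⟨B, rfl⟩ := exists_pushField_eq hq B
    exact ⟨A, B, (isParallel_pushField_iff hq hγ).1 hA, (isParallel_pushField_iff hq hγ).1 hB,
      (hinj _ _ _).1 hAt, (hinj _ _ _).1 hBt,
      (isPositiveBasis_tangentMap_iff hq hp ho (A 0) (B 0)).1 hAB⟩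
  · rintro ⟨A, B, hA, hB, hAt, hBt, hAB⟩
    exact ⟨pushField q γ A, pushField q γ B, (isParallel_pushField_iff hq hγ).2 hA,
      (isParallel_pushField_iff hq hγ).2 hB, (hinj _ _ _).2 hAt, (hinj _ _ _).2 hBt,
      (isPositiveBasis_tangentMap_iff hq hp ho (A 0) (B 0)).2 hAB⟩

lemma tangentMap_unitTangent (hq : IsRiemannianCovering g' g q) {γ : unitInterval → S'}
    (hγ : ContMDiff (𝓡∂ 1) (𝓡 2) 1 γ) (t : unitInterval) :
    tangentMap (𝓡 2) (𝓡 2) q ⟨γ t, unitTangent g' γ t⟩ =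
      (⟨q (γ t), unitTangent g (fun t => q (γ t)) t⟩ : TangentBundle (𝓡 2) S) := by
  rw [unitTangent_comp hq hγ]
  rfl

lemma eq_of_tangentMap_eq (hq : IsRiemannianCovering g' g q) {a b : TangentBundle (𝓡 2) S'}
    (hab : a.proj = b.proj) (h : tangentMap (𝓡 2) (𝓡 2) q a = tangentMap (𝓡 2) (𝓡 2) q b) :
    a = b := by
  obtain ⟨x, a⟩ := a
  obtain ⟨y, b⟩ := b
  obtain rfl : x = y := hab
  simp only [tangentMap, Bundle.TotalSpace.mk_inj] at h
  rw [(hq.isInvertible x).injective h]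

variable {κ₁ κ₂ : EReal} {u v : UnitTangent g} {u' : UnitTangent g'}
  {o' : Orientation ℝ (TangentSpace (𝓡 2) u'.1.proj) (Fin 2)}
  {o : Orientation ℝ (TangentSpace (𝓡 2) u.1.proj) (Fin 2)}

/-- A curve starting at the base point of `u'` is admissible if and only if its projection is. -/
lemma isAdmissible_comp_iff (hq : IsRiemannianCovering g' g q)
    (hu : tangentMap (𝓡 2) (𝓡 2) q u'.1 = u.1) (ho : PreservesOrientation q o' o)
    {v' : UnitTangent g'} (hv : tangentMap (𝓡 2) (𝓡 2) q v'.1 = v.1)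
    {γ : unitInterval → S'} (hγ : ContMDiff (𝓡∂ 1) (𝓡 2) 2 γ) (h0 : γ 0 = u'.1.proj)
    (h1 : γ 1 = v'.1.proj) :
    IsAdmissible g κ₁ κ₂ u v o (fun t => q (γ t)) ↔ IsAdmissible g' κ₁ κ₂ u' v' o' γ := by
  have hγ1 : ContMDiff (𝓡∂ 1) (𝓡 2) 1 γ := hγ.of_le (by norm_num)
  have hp : q u'.1.proj = u.1.proj := congrArg (fun w => w.proj) hu
  have hreg : ∀ t, velocity (fun t => q (γ t)) t ≠ 0 ↔ velocity γ t ≠ 0 := by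
    intro t
    rw [velocity_comp hq.contMDiff hγ1]
    exact not_congr (map_eq_zero_iff _ (hq.isInvertible (γ t)).injective)
  constructor
  · intro h
    refine ⟨fun t => (hreg t).1 (h.regular t), ?_, ?_, ?_⟩
    · apply eq_of_tangentMap_eq hq h0
      rw [tangentMap_unitTangent hq hγ1, hu]
      exact h.initial
    · apply eq_of_tangentMap_eq hq h1
      rw [tangentMap_unitTangent hq hγ1, hv]
      exact h.final
    · obtain ⟨N, hN, hκ⟩ := h.curvature_mem
      obtain ⟨N, rfl⟩ := exists_pushField_eq hq N
      refine ⟨N, (isUnitNormal_pushField_iff hq hp ho hγ1 h0 N).1 hN, fun t => ?_⟩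
      rw [← curvature_comp hq hγ]
      exact hκ t
  · intro h
    refine ⟨fun t => (hreg t).2 (h.regular t), ?_, ?_, ?_⟩
    · rw [← tangentMap_unitTangent hq hγ1, h.initial, hu]
    · rw [← tangentMap_unitTangent hq hγ1, h.final, hv]
    · obtain ⟨N, hN, hκ⟩ := h.curvature_mem
      refine ⟨pushField q γ N, (isUnitNormal_pushField_iff hq hp ho hγ1 h0 N).2 hN, fun t => ?_⟩
      rw [curvature_comp hq hγ]
      exact hκ t

end Admissible

/-! ### The `C^r` topology: evaluation and a local continuity criterion. -/

section CrTopology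

variable {S : Type*} [TopologicalSpace S] [ChartedSpace Plane S] [IsManifold (𝓡 2) ∞ S] {r : ℕ∞}

lemma crNhd_mem_nhds (γ : CrCurve S r) {φ : OpenPartialHomeomorph S Plane}
    (hφ : φ ∈ IsManifold.maximalAtlas (𝓡 2) ∞ S) {K : Set unitInterval} (hK : IsCompact K)
    (hγ : ∀ t ∈ K, γ.toFun t ∈ φ.source) {k : ℕ} (hk : (k : ℕ∞) ≤ r) {ε : ℝ} (hε : 0 < ε) :
    crNhd γ φ K k ε ∈ 𝓝 γ := by
  have h : IsOpen (crNhd γ φ K k ε) :=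
    TopologicalSpace.isOpen_generateFrom_of_mem ⟨γ, φ, K, k, ε, hφ, hK, hγ, hk, hε, rfl⟩
  exact h.mem_nhds fun t ht => ⟨hγ t ht, fun j _ => by rwa [sub_self, norm_zero]⟩

lemma exists_isCompact_nhds_subset {t : unitInterval} {U : Set unitInterval} (hU : U ∈ 𝓝 t) :
    ∃ K ∈ 𝓝 t, K ⊆ U ∧ IsCompact K := by
  obtain ⟨K, hK, hKU, hKc⟩ := local_compact_nhds hU
  exact ⟨K, hK, hKU, hKc⟩

/-- Evaluation is jointly continuous for the `C^r` topology. -/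
lemma continuous_eval : Continuous fun p : unitInterval × CrCurve S r => p.2.toFun p.1 := by
  rw [continuous_iff_continuousAt]
  rintro ⟨t, γ⟩
  intro W hW
  obtain ⟨V, hVW, hV, htV⟩ := mem_nhds_iff.1 hW
  -- In a chart with domain inside `V`, the domain condition of a basic neighbourhood already forces
  -- values into `V`; order `0` and radius `1` below are arbitrary.
  have hφ : (chartAt Plane (γ.toFun t)).restr V ∈ IsManifold.maximalAtlas (𝓡 2) ∞ S :=
    restr_mem_maximalAtlas _ (IsManifold.chart_mem_maximalAtlas _) hV
  have hsrc : ((chartAt Plane (γ.toFun t)).restr V).source =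
      (chartAt Plane (γ.toFun t)).source ∩ V := by
    rw [OpenPartialHomeomorph.restr_source, hV.interior_eq]
  have ht : γ.toFun t ∈ ((chartAt Plane (γ.toFun t)).restr V).source := by
    rw [hsrc]
    exact ⟨mem_chart_source _ _, htV⟩
  obtain ⟨K, hK, hKU, hKc⟩ := exists_isCompact_nhds_subset
    (γ.contMDiff.continuous.continuousAt.preimage_mem_nhds
      (((chartAt Plane (γ.toFun t)).restr V).open_source.mem_nhds ht))
  have h := crNhd_mem_nhds γ hφ hKc hKU (k := 0) (by simp) zero_lt_one
  rw [mem_map]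
  refine mem_of_superset (prod_mem_nhds hK h) ?_
  rintro ⟨s, η⟩ ⟨hs, hη⟩
  have h1 := (hη s hs).1
  rw [hsrc] at h1
  exact hVW h1.2

lemma continuousAt_iteratedDerivWithin_coordCurve {φ : OpenPartialHomeomorph S Plane}
    (hφ : φ ∈ IsManifold.maximalAtlas (𝓡 2) ∞ S) (γ : CrCurve S r) {j : ℕ} (hj : (j : ℕ∞) ≤ r)
    {t : unitInterval} (ht : γ.toFun t ∈ φ.source) :
    ContinuousAt (fun s : unitInterval =>
      iteratedDerivWithin j (coordCurve φ γ.toFun) (Icc 0 1) (s : ℝ)) t := by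
  have h1 : ContDiffWithinAt ℝ r (coordCurve φ γ.toFun) (Icc 0 1) t :=
    contDiffWithinAt_coordCurve hφ (WithTop.coe_le_coe.2 le_top) (γ.contMDiff t) ht
  have h2 := h1.iteratedFDerivWithin_right (m := 0) (i := j) (uniqueDiffOn_Icc zero_lt_one)
    (by rw [zero_add]; exact mod_cast hj) t.2
  have h3 : ContinuousWithinAt (iteratedDerivWithin j (coordCurve φ γ.toFun) (Icc 0 1))
      (Icc 0 1) t := by
    have h4 := h2.continuousWithinAt
    have h5 : Continuous fun T : ContinuousMultilinearMap ℝ (fun _ : Fin j => ℝ) Plane =>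
      T fun _ => 1 := continuous_eval_const _
    exact h5.continuousAt.comp_continuousWithinAt h4
  exact (h3.tendsto).comp (tendsto_nhdsWithin_iff.2
    ⟨continuous_subtype_val.continuousAt, Eventually.of_forall fun s => s.2⟩)

/-- A local criterion for continuity into the space of `C^r` curves. -/
lemma continuousAt_crCurve {X : Type*} [TopologicalSpace X] {A : X → CrCurve S r} {x₀ : X}
    (h : ∀ (t₀ : unitInterval) (φ : OpenPartialHomeomorph S Plane) (k : ℕ) (δ : ℝ),
      φ ∈ IsManifold.maximalAtlas (𝓡 2) ∞ S → (A x₀).toFun t₀ ∈ φ.source → (k : ℕ∞) ≤ r →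
      0 < δ → ∃ N ∈ 𝓝 t₀, ∀ᶠ x in 𝓝 x₀, ∀ t ∈ N, (A x).toFun t ∈ φ.source ∧ ∀ j ≤ k,
        ‖iteratedDerivWithin j (coordCurve φ (A x).toFun) (Icc 0 1) (t : ℝ) -
          iteratedDerivWithin j (coordCurve φ (A x₀).toFun) (Icc 0 1) (t : ℝ)‖ < δ) :
    ContinuousAt A x₀ := by
  rw [ContinuousAt, TopologicalSpace.tendsto_nhds_generateFrom_iff]
  -- The subbasic set is centred at some `γ₀`, not at `A x₀`; compactness of `K` reduces the
  -- estimate to one near each `t`.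
  rintro _ ⟨γ₀, φ, K, k, ε, hφ, hK, hγ₀, hk, -, rfl⟩ hmem
  let D : CrCurve S r → ℕ → unitInterval → Plane := fun γ j t =>
    iteratedDerivWithin j (coordCurve φ γ.toFun) (Icc 0 1) (t : ℝ)
  suffices H : ∀ᶠ x in 𝓝 x₀, ∀ t ∈ K, (A x).toFun t ∈ φ.source ∧ ∀ j ≤ k,
      ‖D (A x) j t - D γ₀ j t‖ < ε from H
  have hmem' : ∀ t ∈ K, (A x₀).toFun t ∈ φ.source ∧ ∀ j ≤ k,
      ‖D (A x₀) j t - D γ₀ j t‖ < ε := hmem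
  refine hK.induction_on (p := fun K => ∀ᶠ x in 𝓝 x₀, ∀ t ∈ K, (A x).toFun t ∈ φ.source ∧
    ∀ j ≤ k, ‖D (A x) j t - D γ₀ j t‖ < ε) (by simp)
    (fun s t hst ht => ht.mono fun x hx y hy => hx y (hst hy)) ?_ ?_
  · intro s t hs ht
    filter_upwards [hs, ht] with x h1 h2 y hy
    exact hy.elim (h1 y) (h2 y)
  · intro t ht
    obtain ⟨hsrc, hlt⟩ := hmem' t ht
    -- Some `δ` fits in the slack left at `t` for all of the finitely many orders; by continuity of
    -- the derivatives it still fits near `t`, and the triangle inequality concludes.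
    have hδ : ∀ᶠ δ in 𝓝[>] (0 : ℝ), ∀ j ∈ Finset.range (k + 1),
        ‖D (A x₀) j t - D γ₀ j t‖ + δ < ε := by
      rw [eventually_all_finset]
      intro j hj
      have hc : Tendsto (fun δ : ℝ => ‖D (A x₀) j t - D γ₀ j t‖ + δ) (𝓝[>] 0)
          (𝓝 (‖D (A x₀) j t - D γ₀ j t‖ + 0)) :=
        tendsto_const_nhds.add (tendsto_id.mono_left nhdsWithin_le_nhds)
      exact hc.eventually_lt_const (by
        rw [add_zero]; exact hlt j (Nat.lt_succ_iff.1 (Finset.mem_range.1 hj)))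
    obtain ⟨δ, hδ, hδ0⟩ := (hδ.and self_mem_nhdsWithin).exists
    have hN : ∀ᶠ s in 𝓝 t, ∀ j ∈ Finset.range (k + 1),
        ‖D (A x₀) j s - D γ₀ j s‖ + δ < ε := by
      rw [eventually_all_finset]
      intro j hj
      have hjr : (j : ℕ∞) ≤ r :=
        le_trans (Nat.cast_le.2 (Nat.lt_succ_iff.1 (Finset.mem_range.1 hj))) hk
      have hc := (((continuousAt_iteratedDerivWithin_coordCurve hφ (A x₀) hjr hsrc).sub
        (continuousAt_iteratedDerivWithin_coordCurve hφ γ₀ hjr (hγ₀ t ht))).norm).add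
          (continuousAt_const (y := δ))
      exact hc.eventually_lt_const (hδ j hj)
    obtain ⟨N, hNt, hN'⟩ := h t φ k δ hφ hsrc hk hδ0
    refine ⟨N ∩ {s | ∀ j ∈ Finset.range (k + 1), ‖D (A x₀) j s - D γ₀ j s‖ + δ < ε},
      mem_nhdsWithin_of_mem_nhds (inter_mem hNt hN), ?_⟩
    filter_upwards [hN'] with x hx s hs
    refine ⟨(hx s hs.1).1, fun j hj => ?_⟩
    have h1 := (hx s hs.1).2 j hj
    have h2 := hs.2 j (Finset.mem_range.2 (Nat.lt_succ_iff.2 hj))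
    have h3 := norm_sub_le_norm_sub_add_norm_sub (D (A x) j s) (D (A x₀) j s) (D γ₀ j s)
    change ‖D (A x) j s - D (A x₀) j s‖ < δ at h1
    linarith

end CrTopology

/-! ### Projection and lifting of curves in the `C^r` topology. -/

section Covering

variable {S' S : Type*}
  [TopologicalSpace S'] [ChartedSpace Plane S'] [IsManifold (𝓡 2) ∞ S']
  [TopologicalSpace S] [ChartedSpace Plane S] [IsManifold (𝓡 2) ∞ S]
  {q : S' → S} {g' : SurfaceMetric S'} {g : SurfaceMetric S} {r : ℕ∞}

lemma exists_openPartialHomeomorph (hq : IsLocalDiffeomorph (𝓡 2) (𝓡 2) ∞ q) (x : S') :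
    ∃ Q : OpenPartialHomeomorph S' S, x ∈ Q.source ∧ EqOn q Q Q.source ∧
      ContMDiffOn (𝓡 2) (𝓡 2) ∞ Q Q.source ∧ ContMDiffOn (𝓡 2) (𝓡 2) ∞ Q.symm Q.target := by
  obtain ⟨P, hx, hP⟩ := hq x
  exact ⟨P.toOpenPartialHomeomorph, hx, hP, P.contMDiffOn_toFun, P.contMDiffOn_invFun⟩

/-- Used for a local restriction of `q` and for its inverse, to move charts between `S` and `S'`. -/
lemma trans_mem_maximalAtlas {Q : OpenPartialHomeomorph S' S}
    (hQ : ContMDiffOn (𝓡 2) (𝓡 2) ∞ Q Q.source)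
    (hQ' : ContMDiffOn (𝓡 2) (𝓡 2) ∞ Q.symm Q.target) {φ : OpenPartialHomeomorph S Plane}
    (hφ : φ ∈ IsManifold.maximalAtlas (𝓡 2) ∞ S) :
    Q ≫ₕ φ ∈ IsManifold.maximalAtlas (𝓡 2) ∞ S' := by
  apply OpenPartialHomeomorph.mem_maximalAtlas_of_contMDiffOn
  · rw [OpenPartialHomeomorph.trans_source, OpenPartialHomeomorph.coe_trans]
    exact (contMDiffOn_of_mem_maximalAtlas hφ).comp (hQ.mono inter_subset_left) fun x hx => hx.2
  · rw [OpenPartialHomeomorph.trans_target, OpenPartialHomeomorph.coe_trans_symm]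
    exact hQ'.comp ((contMDiffOn_symm_of_mem_maximalAtlas hφ).mono inter_subset_left)
      fun x hx => hx.2

/-- The image of a `C^r` curve under a smooth map. -/
def CrCurve.map (hq : ContMDiff (𝓡 2) (𝓡 2) ∞ q) (γ : CrCurve S' r) : CrCurve S r where
  toFun t := q (γ.toFun t)
  contMDiff := (hq.of_le (WithTop.coe_le_coe.2 le_top)).comp γ.contMDiff

/-- In charts matched by `q` the two coordinate curves have the same germ, so no higher-order chain
rule is needed. -/
lemma iteratedDerivWithin_coordCurve_congr {ψ : OpenPartialHomeomorph S' Plane}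
    {φ : OpenPartialHomeomorph S Plane} {γ : unitInterval → S'} (hγ : Continuous γ) {U : Set S'}
    (hU : IsOpen U) (hUφ : ∀ x ∈ U, ψ x = φ (q x)) {t : unitInterval} (ht : γ t ∈ U) (j : ℕ) :
    iteratedDerivWithin j (coordCurve ψ γ) (Icc 0 1) (t : ℝ) =
      iteratedDerivWithin j (coordCurve φ fun t => q (γ t)) (Icc 0 1) (t : ℝ) := by
  have h : coordCurve ψ γ =ᶠ[𝓝[Icc (0 : ℝ) 1] (t : ℝ)] coordCurve φ fun t => q (γ t) := by
    filter_upwards [eventually_mem_of_isOpen hγ hU ht] with s hs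
    exact hUφ _ hs
  exact h.iteratedDerivWithin_eq (h.self_of_nhdsWithin t.2)

/-- A test chart `φ` downstairs is pulled back to `Q ≫ₕ φ`, where the same `k` and `δ` work. -/
lemma continuous_map (hq : IsLocalDiffeomorph (𝓡 2) (𝓡 2) ∞ q) :
    Continuous (CrCurve.map (r := r) hq.contMDiff) := by
  rw [continuous_iff_continuousAt]
  intro γ
  refine continuousAt_crCurve fun t φ k δ hφ ht hk hδ => ?_
  obtain ⟨Q, hx, hQq, hQ, hQ'⟩ := exists_openPartialHomeomorph hq (γ.toFun t)
  have hsrc : γ.toFun t ∈ (Q ≫ₕ φ).source := by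
    rw [OpenPartialHomeomorph.trans_source]
    refine ⟨hx, ?_⟩
    rw [mem_preimage, ← hQq hx]
    exact ht
  have hUφ : ∀ x ∈ (Q ≫ₕ φ).source, (Q ≫ₕ φ) x = φ (q x) := by
    intro x hx
    rw [OpenPartialHomeomorph.trans_source] at hx
    rw [hQq hx.1]
    rfl
  obtain ⟨N, hN, hNU, hNc⟩ := exists_isCompact_nhds_subset
    (γ.contMDiff.continuous.continuousAt.preimage_mem_nhds
      ((Q ≫ₕ φ).open_source.mem_nhds hsrc))
  refine ⟨N, hN, ?_⟩
  filter_upwards [crNhd_mem_nhds γ (trans_mem_maximalAtlas hQ hQ' hφ) hNc hNU hk hδ] with η hη s hs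
  obtain ⟨h1, h2⟩ := hη s hs
  refine ⟨?_, fun j hj => ?_⟩
  · have h3 := h1
    rw [OpenPartialHomeomorph.trans_source] at h3
    have h4 := h3.2
    rw [mem_preimage, ← hQq h3.1] at h4
    exact h4
  · have e1 := iteratedDerivWithin_coordCurve_congr η.contMDiff.continuous
      (Q ≫ₕ φ).open_source hUφ h1 j
    have e2 := iteratedDerivWithin_coordCurve_congr γ.contMDiff.continuous
      (Q ≫ₕ φ).open_source hUφ (hNU hs) j
    have h3 := h2 j hj
    change ‖iteratedDerivWithin j (coordCurve (Q ≫ₕ φ) η.toFun) (Icc 0 1) (s : ℝ) -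
      iteratedDerivWithin j (coordCurve (Q ≫ₕ φ) γ.toFun) (Icc 0 1) (s : ℝ)‖ < δ at h3
    rw [e1, e2] at h3
    exact h3

/-- A family of lifts of `C^r` curves which is jointly continuous is continuous for the
`C^r` topology. -/
lemma continuous_of_map_continuous (hq : IsLocalDiffeomorph (𝓡 2) (𝓡 2) ∞ q) {X : Type*}
    [TopologicalSpace X] {L : X → CrCurve S' r}
    (hL : Continuous fun x => (L x).map hq.contMDiff)
    (hL' : Continuous fun p : unitInterval × X => (L p.2).toFun p.1) : Continuous L := by
  rw [continuous_iff_continuousAt]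
  intro x₀
  refine continuousAt_crCurve fun t ψ k δ hψ ht hk hδ => ?_
  obtain ⟨Q, hx, hQq, hQ, hQ'⟩ := exists_openPartialHomeomorph hq ((L x₀).toFun t)
  have hW : IsOpen (Q.source ∩ ψ.source) := Q.open_source.inter ψ.open_source
  have hφ : Q.symm ≫ₕ ψ ∈ IsManifold.maximalAtlas (𝓡 2) ∞ S :=
    trans_mem_maximalAtlas hQ' hQ hψ
  have hUψ : ∀ x ∈ Q.source ∩ ψ.source, ψ x = (Q.symm ≫ₕ ψ) (q x) := by
    intro x hx
    rw [hQq hx.1, OpenPartialHomeomorph.coe_trans, Function.comp_apply, Q.left_inv hx.1]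
  have hsrc : ∀ x ∈ Q.source ∩ ψ.source, q x ∈ (Q.symm ≫ₕ ψ).source := by
    intro x hx
    rw [OpenPartialHomeomorph.trans_source, hQq hx.1]
    refine ⟨Q.map_source hx.1, ?_⟩
    rw [mem_preimage, Q.left_inv hx.1]
    exact hx.2
  -- Joint continuity keeps nearby lifts in the sheet `Q.source`; closeness of the projections alone
  -- would not.
  have hmem : ∀ᶠ p : unitInterval × X in 𝓝 t ×ˢ 𝓝 x₀,
      (L p.2).toFun p.1 ∈ Q.source ∩ ψ.source := by
    rw [← nhds_prod_eq]
    exact hL'.continuousAt.preimage_mem_nhds (hW.mem_nhds ⟨hx, ht⟩)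
  obtain ⟨N₀, hN₀, U, hU, hNU⟩ := mem_prod_iff.1 hmem
  obtain ⟨N, hN, hNN₀, hNc⟩ := exists_isCompact_nhds_subset hN₀
  have hLW : ∀ x ∈ U, ∀ s ∈ N, (L x).toFun s ∈ Q.source ∩ ψ.source := fun x hx s hs =>
    hNU (mk_mem_prod (hNN₀ hs) hx)
  have hx₀ := mem_of_mem_nhds hU
  refine ⟨N, hN, ?_⟩
  filter_upwards [hU, hL.continuousAt.preimage_mem_nhds (crNhd_mem_nhds
    ((L x₀).map hq.contMDiff) hφ hNc (fun s hs => hsrc _ (hLW x₀ hx₀ s hs)) hk hδ)] with x hxU hx s hs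
  refine ⟨(hLW x hxU s hs).2, fun j hj => ?_⟩
  rw [iteratedDerivWithin_coordCurve_congr (L x).contMDiff.continuous hW hUψ (hLW x hxU s hs),
    iteratedDerivWithin_coordCurve_congr (L x₀).contMDiff.continuous hW hUψ (hLW x₀ hx₀ s hs)]
  exact (hx s hs).2 j hj

/-- The continuous lift agrees near each parameter with a smooth local inverse of `q` composed with
`γ`. -/
lemma exists_crCurve_lift (hq : IsRiemannianCovering g' g q) (γ : CrCurve S r) {p' : S'}
    (h0 : γ.toFun 0 = q p') :
    ∃ η : CrCurve S' r, η.toFun 0 = p' ∧ ∀ t, q (η.toFun t) = γ.toFun t := by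
  obtain ⟨Γ, hΓ, hΓ0⟩ := hq.isCoveringMap.exists_path_lifts ⟨γ.toFun, γ.contMDiff.continuous⟩ p' h0
  have hΓ' : ∀ t, q (Γ t) = γ.toFun t := fun t => congrFun hΓ t
  refine ⟨⟨Γ, fun t => ?_⟩, hΓ0, hΓ'⟩
  obtain ⟨Q, hx, hQq, hQ, hQ'⟩ := exists_openPartialHomeomorph hq.isLocalDiffeomorph (Γ t)
  have hmem : γ.toFun t ∈ Q.target := by
    rw [← hΓ', hQq hx]
    exact Q.map_source hx
  have h1 := ((hQ'.contMDiffAt (Q.open_target.mem_nhds hmem)).of_le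
    (WithTop.coe_le_coe.2 le_top)).comp t (γ.contMDiff t)
  refine h1.congr_of_eventuallyEq ?_
  filter_upwards [Γ.continuous.continuousAt.preimage_mem_nhds (Q.open_source.mem_nhds hx)] with s hs
  rw [Function.comp_apply, ← hΓ', hQq hs, Q.left_inv hs]

end Covering

/-! ### The projection of curve spaces is bijective with continuous inverse. -/

section Homeomorphism

variable {S' S : Type*}
  [TopologicalSpace S'] [ChartedSpace Plane S'] [IsManifold (𝓡 2) ∞ S']
  [TopologicalSpace S] [ChartedSpace Plane S] [IsManifold (𝓡 2) ∞ S]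
  {q : S' → S} {g' : SurfaceMetric S'} {g : SurfaceMetric S} {r : ℕ∞}
  {κ₁ κ₂ : EReal} {u v : UnitTangent g} {u' : UnitTangent g'}
  {o' : Orientation ℝ (TangentSpace (𝓡 2) u'.1.proj) (Fin 2)}
  {o : Orientation ℝ (TangentSpace (𝓡 2) u.1.proj) (Fin 2)}

lemma CrCurve.ext_toFun {γ η : CrCurve S r} (h : ∀ t, γ.toFun t = η.toFun t) : γ = η := by
  obtain ⟨γ, _⟩ := γ
  obtain ⟨η, _⟩ := η
  congr 1
  exact funext h

lemma CrCurve.contMDiff_two (hr : 2 ≤ r) (γ : CrCurve S r) : ContMDiff (𝓡∂ 1) (𝓡 2) 2 γ.toFun :=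
  γ.contMDiff.of_le (WithTop.coe_le_coe.2 hr)

lemma CrCurve.contMDiff_one (hr : 2 ≤ r) (γ : CrCurve S r) : ContMDiff (𝓡∂ 1) (𝓡 2) 1 γ.toFun :=
  (γ.contMDiff_two hr).of_le (by norm_num)

lemma IsAdmissible.apply_zero {γ : unitInterval → S} (h : IsAdmissible g κ₁ κ₂ u v o γ) :
    γ 0 = u.1.proj := congrArg (fun w => w.proj) h.initial

lemma IsAdmissible.apply_one {γ : unitInterval → S} (h : IsAdmissible g κ₁ κ₂ u v o γ) :
    γ 1 = v.1.proj := congrArg (fun w => w.proj) h.final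

/-- Composition with a Riemannian covering, as a map between spaces of curves. -/
def projectCurve (hq : IsRiemannianCovering g' g q)
    (hr : 2 ≤ r) (hu : tangentMap (𝓡 2) (𝓡 2) q u'.1 = u.1) (ho : PreservesOrientation q o' o)
    (x : Σ v' : TangentLift g' g q v, CurveSpace g' κ₁ κ₂ r u' v'.1 o') :
    CurveSpace g κ₁ κ₂ r u v o :=
  ⟨x.2.1.map hq.contMDiff, (isAdmissible_comp_iff hq hu ho x.1.2 (x.2.1.contMDiff_two hr)
    x.2.2.apply_zero x.2.2.apply_one).2 x.2.2⟩

/-- The index is the terminal unit tangent, hence determined by the curve. -/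
lemma sigma_curveSpace_ext {x y : Σ v' : TangentLift g' g q v, CurveSpace g' κ₁ κ₂ r u' v'.1 o'}
    (h : x.2.1 = y.2.1) : x = y := by
  obtain ⟨v₁, γ, hγ⟩ := x
  obtain ⟨v₂, η, hη⟩ := y
  obtain rfl : γ = η := h
  obtain rfl : v₁ = v₂ := Subtype.ext (Subtype.ext (hγ.final.symm.trans hη.final))
  rfl

lemma projectCurve_injective (hq : IsRiemannianCovering g' g q)
    (hr : 2 ≤ r) (hu : tangentMap (𝓡 2) (𝓡 2) q u'.1 = u.1) (ho : PreservesOrientation q o' o) :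
    Function.Injective (projectCurve (κ₁ := κ₁) (κ₂ := κ₂) (v := v) hq hr hu ho) := by
  intro x y hxy
  apply sigma_curveSpace_ext
  have h : ∀ t, q (x.2.1.toFun t) = q (y.2.1.toFun t) := fun t =>
    congrArg (fun γ => γ.1.toFun t) hxy
  apply CrCurve.ext_toFun
  refine congrFun (hq.isCoveringMap.eq_of_comp_eq x.2.1.contMDiff.continuous
    y.2.1.contMDiff.continuous (funext h) 0 ?_)
  rw [x.2.2.apply_zero, y.2.2.apply_zero]

lemma exists_projectCurve_eq (hq : IsRiemannianCovering g' g q)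
    (hr : 2 ≤ r) (hu : tangentMap (𝓡 2) (𝓡 2) q u'.1 = u.1) (ho : PreservesOrientation q o' o)
    (γ : CurveSpace g κ₁ κ₂ r u v o) :
    ∃ x : Σ v' : TangentLift g' g q v, CurveSpace g' κ₁ κ₂ r u' v'.1 o',
      projectCurve hq hr hu ho x = γ := by
  obtain ⟨η, hη0, hη⟩ := exists_crCurve_lift hq γ.1 (p' := u'.1.proj)
    (γ.2.apply_zero.trans (congrArg (fun w => w.proj) hu).symm)
  have hfun : (fun t => q (η.toFun t)) = γ.1.toFun := funext hη
  have hη1 := η.contMDiff_one hr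
  have hadm : IsAdmissible g κ₁ κ₂ u v o (fun t => q (η.toFun t)) := hfun ▸ γ.2
  -- The summand is indexed by the terminal tangent of the lift, which has length one because its
  -- image `v` does.
  have hunit : g'.inner (η.toFun 1) (unitTangent g' η.toFun 1) (unitTangent g' η.toFun 1) = 1 := by
    have h1 : g.inner (q (η.toFun 1)) (unitTangent g (fun t => q (η.toFun t)) 1)
        (unitTangent g (fun t => q (η.toFun t)) 1) = 1 := by
      have h2 := v.2
      rw [← hadm.final] at h2
      exact h2
    rw [unitTangent_comp hq hη1, inner_pushField hq] at h1
    exact h1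
  have hv : tangentMap (𝓡 2) (𝓡 2) q ⟨η.toFun 1, unitTangent g' η.toFun 1⟩ = v.1 :=
    (tangentMap_unitTangent hq hη1 1).trans hadm.final
  exact ⟨⟨⟨⟨⟨η.toFun 1, unitTangent g' η.toFun 1⟩, hunit⟩, hv⟩, η,
    (isAdmissible_comp_iff hq hu ho hv (η.contMDiff_two hr) hη0 rfl).1 hadm⟩,
    Subtype.ext (CrCurve.ext_toFun hη)⟩

lemma continuous_projectCurve (hq : IsRiemannianCovering g' g q)
    (hr : 2 ≤ r) (hu : tangentMap (𝓡 2) (𝓡 2) q u'.1 = u.1) (ho : PreservesOrientation q o' o) :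
    Continuous (projectCurve (κ₁ := κ₁) (κ₂ := κ₂) (v := v) hq hr hu ho) :=
  continuous_sigma fun _ =>
    ((continuous_map hq.isLocalDiffeomorph).comp continuous_subtype_val).subtype_mk _

/-- A section of the projection of curves is continuous. -/
lemma continuous_of_rightInverse_projectCurve (hq : IsRiemannianCovering g' g q)
    (hr : 2 ≤ r) (hu : tangentMap (𝓡 2) (𝓡 2) q u'.1 = u.1) (ho : PreservesOrientation q o' o)
    {G : CurveSpace g κ₁ κ₂ r u v o →
      Σ v' : TangentLift g' g q v, CurveSpace g' κ₁ κ₂ r u' v'.1 o'}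
    (hG : Function.RightInverse G (projectCurve hq hr hu ho)) : Continuous G := by
  have hqG : ∀ γ t, q ((G γ).2.1.toFun t) = γ.1.toFun t := fun γ t =>
    congrArg (fun η => η.1.toFun t) (hG γ)
  have heval : Continuous fun p : unitInterval × CurveSpace g κ₁ κ₂ r u v o =>
      p.2.1.toFun p.1 :=
    continuous_eval.comp (continuous_fst.prodMk (continuous_subtype_val.comp continuous_snd))
  have hjoint : Continuous fun p : unitInterval × CurveSpace g κ₁ κ₂ r u v o =>
      (G p.2).2.1.toFun p.1 := by
    -- Lifts continuous in the parameter for each curve are jointly continuous once their initial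
    -- points depend continuously on the curve; here these are constant.
    refine hq.isLocalDiffeomorph.isLocalHomeomorph.continuous_lift
      hq.isCoveringMap.isSeparatedMap ⟨_, heval⟩ (funext fun p => hqG p.2 p.1) ?_
      fun γ => (G γ).2.1.contMDiff.continuous
    have h0 : (fun γ => (G γ).2.1.toFun 0) = fun _ => u'.1.proj :=
      funext fun γ => (G γ).2.2.apply_zero
    simp only [h0]
    exact continuous_const
  have hcurve : Continuous fun γ => (G γ).2.1 := by
    refine continuous_of_map_continuous hq.isLocalDiffeomorph ?_ hjoint
    have h1 : (fun γ => (G γ).2.1.map hq.contMDiff) = Subtype.val :=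
      funext fun γ => CrCurve.ext_toFun (hqG γ)
    rw [h1]
    exact continuous_subtype_val
  -- Terminal points of lifts all lie over the base point of `v`, and two of them in one sheet
  -- coincide; injectivity of `dq` then identifies the vectors.
  have hfinal : ∀ γ₁, ∀ᶠ γ in 𝓝 γ₁, (G γ).1 = (G γ₁).1 := by
    intro γ₁
    obtain ⟨Q, hx, hQq, -, -⟩ :=
      exists_openPartialHomeomorph hq.isLocalDiffeomorph ((G γ₁).2.1.toFun 1)
    have h1 : Continuous fun γ => (G γ).2.1.toFun 1 :=
      hjoint.comp (Continuous.prodMk_right (1 : unitInterval))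
    filter_upwards [h1.continuousAt.preimage_mem_nhds (Q.open_source.mem_nhds hx)] with γ hγ
    have h2 : (G γ).2.1.toFun 1 = (G γ₁).2.1.toFun 1 := by
      apply Q.injOn hγ hx
      rw [← hQq hγ, ← hQq hx, hqG, hqG, γ.2.apply_one, γ₁.2.apply_one]
    rw [(G γ).2.2.apply_one, (G γ₁).2.2.apply_one] at h2
    exact Subtype.ext (Subtype.ext
      (eq_of_tangentMap_eq hq h2 ((G γ).1.2.trans (G γ₁).1.2.symm)))
  -- Neighbourhoods in the disjoint union are tested on one summand, with the topology induced from
  -- `CrCurve`. Quantifying over `x` and `y` allows the equality of indices to be eliminated.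
  have key : ∀ x : Σ v' : TangentLift g' g q v, CurveSpace g' κ₁ κ₂ r u' v'.1 o', ∀ W ∈ 𝓝 x,
      ∃ O ∈ 𝓝 x.2.1, ∀ y : Σ v' : TangentLift g' g q v, CurveSpace g' κ₁ κ₂ r u' v'.1 o',
        y.1 = x.1 → y.2.1 ∈ O → y ∈ W := by
    rintro ⟨v₁, c⟩ W hW
    rw [Sigma.nhds_mk, mem_map] at hW
    obtain ⟨O, hO, hOW⟩ := (mem_nhds_induced Subtype.val c _).1 hW
    refine ⟨O, hO, ?_⟩
    rintro ⟨v₂, d⟩ h hd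
    obtain rfl : v₂ = v₁ := h
    exact hOW hd
  rw [continuous_iff_continuousAt]
  intro γ₁ W hW
  obtain ⟨O, hO, hOW⟩ := key _ W hW
  rw [mem_map]
  filter_upwards [hfinal γ₁, hcurve.continuousAt.preimage_mem_nhds hO] with γ h1 h2
  exact hOW _ h1 h2

end Homeomorphism

end CurveSpaces

end

theorem lemma5p3
    {S' S : Type*}
    [TopologicalSpace S'] [T2Space S'] [ChartedSpace CurveSpaces.Plane S']
    [IsManifold (𝓡 2) ∞ S']
    [TopologicalSpace S] [T2Space S] [ChartedSpace CurveSpaces.Plane S]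
    [IsManifold (𝓡 2) ∞ S]
    (g' : CurveSpaces.SurfaceMetric S') (g : CurveSpaces.SurfaceMetric S)
    (q : S' → S) (hq : CurveSpaces.IsRiemannianCovering g' g q)
    (κ₁ κ₂ : EReal) (hκ : κ₁ < κ₂) (r : ℕ∞) (hr : 2 ≤ r)
    (u v : CurveSpaces.UnitTangent g)
    (u' : CurveSpaces.UnitTangent g') (hu : tangentMap (𝓡 2) (𝓡 2) q u'.1 = u.1)
    (o' : Orientation ℝ (TangentSpace (𝓡 2) u'.1.proj) (Fin 2))
    (o : Orientation ℝ (TangentSpace (𝓡 2) u.1.proj) (Fin 2))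
    (ho : CurveSpaces.PreservesOrientation q o' o) :
    ∃ Φ : (Σ v' : CurveSpaces.TangentLift g' g q v,
          CurveSpaces.CurveSpace g' κ₁ κ₂ r u' v'.1 o') ≃ₜ
        CurveSpaces.CurveSpace g κ₁ κ₂ r u v o,
      ∀ x t, (Φ x).1.toFun t = q (x.2.1.toFun t) := by
  choose G hG using CurveSpaces.exists_projectCurve_eq (κ₁ := κ₁) (κ₂ := κ₂) (v := v) hq hr hu ho
  exact ⟨
    { toFun := CurveSpaces.projectCurve hq hr hu ho
      invFun := G
      left_inv := Function.RightInverse.leftInverse_of_injective hG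
        (CurveSpaces.projectCurve_injective hq hr hu ho)
      right_inv := hG
      continuous_toFun := CurveSpaces.continuous_projectCurve hq hr hu ho
      continuous_invFun := CurveSpaces.continuous_of_rightInverse_projectCurve hq hr hu ho hG },
    fun _ _ => rfl⟩
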